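/- Let $(G,H,t,m)$ be a Lie crossed module: $G,H$ are (finite-dimensional, real) Lie groups, $t:H\to G$ is a smooth homomorphism, $m:G\times H\to H$ is a smooth action of $G$ on $H$ by automorphisms, and $t(m(a)(A))=a\,t(A)\,a^{-1}$, $m(t(A))(B)=ABA^{-1}$ for $a\in G$, $A,B\in H$. Let $\mathfrak h$ be the Lie algebra of $H$ and let $\dot m(a):\mathfrak h\to\mathfrak h$ be the differential of $m(a)$ at $1_H$. All maps and forms below are smooth. A $(G,H)$-cocycle $(f,g,W)$ consists of maps $f(x',x;y)\in G$, $g(x;y',y)\in G$, $W(x',x;y',y)\in H$ of real variables with $$t(W(x',x;y',y))=g(x;y',y)^{-1}f(x',x;y')^{-1}g(x';y',y)f(x',x;y),$$ $$f(x'',x;y)=f(x'',x';y)f(x',x;y),\qquad g(x;y'',y)=g(x;y'',y')g(x;y',y),$$ $$W(x'',x;y',y)=W(x',x;y',y)\,m(f(x',x;y)^{-1})(W(x'',x';y',y)),$$ $$W(x',x;y'',y)=m(g(x;y',y)^{-1})(W(x',x;y'',y'))\,W(x',x;y',y).$$ Fix such a cocycle. An $(f,g,W)$-1-gauge transformation $(\kappa,\Psi,\Phi)$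 consists of maps $\kappa(x;y)\in G$, $\Psi(x',x;y)\in H$, $\Phi(x;y',y)\in H$ of real variables with $$\Psi(x'',x;y)=\Psi(x',x;y)\,m(f(x',x;y)^{-1})(\Psi(x'',x';y)),$$ $$\Phi(x;y'',y)=\Phi(x;y',y)\,m(g(x;y',y)^{-1})(\Phi(x;y'',y')).$$ A differential $(G,H)$-1-gauge transformation is a pair $(\varkappa,\Gamma)$ of a map $\varkappa:\mathbb R^2\to G$ and an $\mathfrak h$-valued 1-form $\Gamma=\Gamma_x\,dx+\Gamma_y\,dy$ on $\mathbb R^2$. Then there is a bijection between the set of $(f,g,W)$-1-gauge transformations and the set of differential $(G,H)$-1-gauge transformations, given explicitly as follows. The pair $(\varkappa,\Gamma)$ corresponding to $(\kappa,\Psi,\Phi)$ is $$\varkappa(x,y)=\kappa(x;y),$$ $$\Gamma_x(x,y)=-\dot m(\kappa(x;y))\big(\Psi(x',x;y)^{-1}\partial_{x'}\Psi(x',x;y)\big|_{x'=x}\big),$$ $$\Gamma_y(x,y)=-\dot m(\kappa(x;y))\big(\Phi(x;y',y)^{-1}\partial_{y'}\Phi(x;y',y)\big|_{y'=y}\big).$$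 Conversely, the triple $(\kappa,\Psi,\Phi)$ corresponding to $(\varkappa,\Gamma)$ is $\kappa(x;y)=\varkappa(x,y)$, $\Psi(x,x_0;y)=\Lambda_{|y,x_0}(x)$, $\Phi(x;y,y_0)=\Xi_{|x,y_0}(y)$, where for all fixed $y,x_0$ (respectively $x,y_0$) the curves $\Lambda_{|y,x_0},\Xi_{|x,y_0}:\mathbb R\to H$ are the unique solutions of $$\Lambda_{|y,x_0}(x)^{-1}\partial_x\Lambda_{|y,x_0}(x)=-\dot m\big(f(x,x_0;y)^{-1}\varkappa(x,y)^{-1}\big)(\Gamma_x(x,y)),\qquad \Lambda_{|y,x_0}(x_0)=1_H,$$ $$\Xi_{|x,y_0}(y)^{-1}\partial_y\Xi_{|x,y_0}(y)=-\dot m\big(g(x;y,y_0)^{-1}\varkappa(x,y)^{-1}\big)(\Gamma_y(x,y)),\qquad \Xi_{|x,y_0}(y_0)=1_H.$$ -/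

import Mathlib

open scoped Manifold ContDiff

noncomputable section

namespace HigherGauge

/-- The left logarithmic derivative `γ(s)⁻¹ (dγ/ds)(s)` of a curve `γ` in a Lie group `H`: the
velocity of `γ` at `s`, translated to the identity by left multiplication with `γ(s)⁻¹`.
(The translated vector lives in the tangent space at `γ(s)⁻¹ * γ(s) = 1`.) -/
def leftLogDeriv {E : Type*} [NormedAddCommGroup E] [NormedSpace ℝ E]
    {H : Type*} [TopologicalSpace H] [ChartedSpace E H] [Group H]
    (γ : ℝ → H) (s : ℝ) : GroupLieAlgebra 𝓘(ℝ, E) H :=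
  mfderiv 𝓘(ℝ, E) 𝓘(ℝ, E) (fun h : H => (γ s)⁻¹ * h) (γ s)
    (mfderiv 𝓘(ℝ, ℝ) 𝓘(ℝ, E) γ s (1 : ℝ))

/-- A Lie crossed module `(G, H, t, m)`: Lie groups `G`, `H`, a smooth homomorphism `t : H → G`
and a smooth action `m` of `G` on `H` by automorphisms, such that `t` is equivariant and the
Peiffer identity holds. -/
structure LieCrossedModule
    (EG : Type*) [NormedAddCommGroup EG] [NormedSpace ℝ EG]
    (G : Type*) [TopologicalSpace G] [ChartedSpace EG G] [Group G] [LieGroup 𝓘(ℝ, EG) ∞ G]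
    (EH : Type*) [NormedAddCommGroup EH] [NormedSpace ℝ EH]
    (H : Type*) [TopologicalSpace H] [ChartedSpace EH H] [Group H] [LieGroup 𝓘(ℝ, EH) ∞ H] where
  t : H →* G
  m : G →* MulAut H
  contMDiff_t : ContMDiff 𝓘(ℝ, EH) 𝓘(ℝ, EG) ∞ t
  contMDiff_m : ContMDiff (𝓘(ℝ, EG).prod 𝓘(ℝ, EH)) 𝓘(ℝ, EH) ∞ (fun p : G × H => m p.1 p.2)
  equivariant : ∀ (a : G) (A : H), t (m a A) = a * t A * a⁻¹
  peiffer : ∀ A B : H, m (t A) B = A * B * A⁻¹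

section

variable {EG : Type*} [NormedAddCommGroup EG] [NormedSpace ℝ EG]
  {G : Type*} [TopologicalSpace G] [ChartedSpace EG G] [Group G] [LieGroup 𝓘(ℝ, EG) ∞ G]
  {EH : Type*} [NormedAddCommGroup EH] [NormedSpace ℝ EH]
  {H : Type*} [TopologicalSpace H] [ChartedSpace EH H] [Group H] [LieGroup 𝓘(ℝ, EH) ∞ H]

/-- `ṁ(a)`, the differential at `1` of the automorphism `m(a)` of `H`, acting on the Lie algebra
of `H`. (It takes values in the tangent space at `m(a)(1) = 1`.) -/
def LieCrossedModule.mDot (X : LieCrossedModule EG G EH H) (a : G)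
    (v : GroupLieAlgebra 𝓘(ℝ, EH) H) : GroupLieAlgebra 𝓘(ℝ, EH) H :=
  mfderiv 𝓘(ℝ, EH) 𝓘(ℝ, EH) (fun h : H => X.m a h) (1 : H) v

/-- A `(G, H)`-cocycle. The arguments are ordered as `f(x', x; y)`, `g(x; y', y)` and
`W(x', x; y', y)`. -/
structure Cocycle (X : LieCrossedModule EG G EH H) where
  f : ℝ → ℝ → ℝ → G
  g : ℝ → ℝ → ℝ → G
  W : ℝ → ℝ → ℝ → ℝ → H
  contMDiff_f : ContMDiff 𝓘(ℝ, ℝ × ℝ × ℝ) 𝓘(ℝ, EG) ∞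
    (fun p : ℝ × ℝ × ℝ => f p.1 p.2.1 p.2.2)
  contMDiff_g : ContMDiff 𝓘(ℝ, ℝ × ℝ × ℝ) 𝓘(ℝ, EG) ∞
    (fun p : ℝ × ℝ × ℝ => g p.1 p.2.1 p.2.2)
  contMDiff_W : ContMDiff 𝓘(ℝ, ℝ × ℝ × ℝ × ℝ) 𝓘(ℝ, EH) ∞
    (fun p : ℝ × ℝ × ℝ × ℝ => W p.1 p.2.1 p.2.2.1 p.2.2.2)
  target : ∀ x' x y' y : ℝ,
    X.t (W x' x y' y) = (g x y' y)⁻¹ * (f x' x y')⁻¹ * g x' y' y * f x' x y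
  f_comp : ∀ x'' x' x y : ℝ, f x'' x y = f x'' x' y * f x' x y
  g_comp : ∀ x y'' y' y : ℝ, g x y'' y = g x y'' y' * g x y' y
  W_comp_x : ∀ x'' x' x y' y : ℝ,
    W x'' x y' y = W x' x y' y * X.m (f x' x y)⁻¹ (W x'' x' y' y)
  W_comp_y : ∀ x' x y'' y' y : ℝ,
    W x' x y'' y = X.m (g x y' y)⁻¹ (W x' x y'' y') * W x' x y' y

/-- An `(f, g, W)`-1-gauge transformation `(κ, Ψ, Φ)`, for a cocycle `c = (f, g, W)`. The
arguments are ordered as `κ(x; y)`, `Ψ(x', x; y)` and `Φ(x; y', y)`. -/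
structure IntegralGauge {X : LieCrossedModule EG G EH H} (c : Cocycle X) where
  κ : ℝ → ℝ → G
  Ψ : ℝ → ℝ → ℝ → H
  Φ : ℝ → ℝ → ℝ → H
  contMDiff_κ : ContMDiff 𝓘(ℝ, ℝ × ℝ) 𝓘(ℝ, EG) ∞ (fun p : ℝ × ℝ => κ p.1 p.2)
  contMDiff_Ψ : ContMDiff 𝓘(ℝ, ℝ × ℝ × ℝ) 𝓘(ℝ, EH) ∞
    (fun p : ℝ × ℝ × ℝ => Ψ p.1 p.2.1 p.2.2)
  contMDiff_Φ : ContMDiff 𝓘(ℝ, ℝ × ℝ × ℝ) 𝓘(ℝ, EH) ∞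
    (fun p : ℝ × ℝ × ℝ => Φ p.1 p.2.1 p.2.2)
  Ψ_comp : ∀ x'' x' x y : ℝ,
    Ψ x'' x y = Ψ x' x y * X.m (c.f x' x y)⁻¹ (Ψ x'' x' y)
  Φ_comp : ∀ x y'' y' y : ℝ,
    Φ x y'' y = Φ x y' y * X.m (c.g x y' y)⁻¹ (Φ x y'' y')

end

/-- A differential `(G, H)`-1-gauge transformation: a smooth map `ϰ : ℝ² → G` and a smooth
1-form `Γ` on `ℝ²` with values in the Lie algebra of `H`. Smoothness of `Γ` is expressed in the
normed space `EH` that underlies the tangent space of `H` at `1`. -/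
structure DifferentialGauge
    (EG : Type*) [NormedAddCommGroup EG] [NormedSpace ℝ EG]
    (G : Type*) [TopologicalSpace G] [ChartedSpace EG G]
    (EH : Type*) [NormedAddCommGroup EH] [NormedSpace ℝ EH]
    (H : Type*) [TopologicalSpace H] [ChartedSpace EH H] [Group H] where
  ϰ : ℝ × ℝ → G
  Γ : ℝ × ℝ → (ℝ × ℝ →L[ℝ] GroupLieAlgebra 𝓘(ℝ, EH) H)
  contMDiff_ϰ : ContMDiff 𝓘(ℝ, ℝ × ℝ) 𝓘(ℝ, EG) ∞ ϰ
  contDiff_Γ : ContDiff ℝ ∞ (F := ℝ × ℝ →L[ℝ] EH) Γ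

namespace DifferentialGauge

variable {EG : Type*} [NormedAddCommGroup EG] [NormedSpace ℝ EG]
  {G : Type*} [TopologicalSpace G] [ChartedSpace EG G]
  {EH : Type*} [NormedAddCommGroup EH] [NormedSpace ℝ EH]
  {H : Type*} [TopologicalSpace H] [ChartedSpace EH H] [Group H]

/-- The component `Γ_x(x, y)` of the 1-form `Γ = Γ_x dx + Γ_y dy`. -/
def Γx (D : DifferentialGauge EG G EH H) (x y : ℝ) : GroupLieAlgebra 𝓘(ℝ, EH) H :=
  D.Γ (x, y) ((1 : ℝ), (0 : ℝ))

/-- The component `Γ_y(x, y)` of the 1-form `Γ = Γ_x dx + Γ_y dy`. -/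
def Γy (D : DifferentialGauge EG G EH H) (x y : ℝ) : GroupLieAlgebra 𝓘(ℝ, EH) H :=
  D.Γ (x, y) ((0 : ℝ), (1 : ℝ))

end DifferentialGauge

/-- `γ` is a (differentiable, globally defined) solution of the initial value problem
`γ(s)⁻¹ γ'(s) = ξ(s)`, `γ(s₀) = 1` in the Lie group `H`. -/
def SolvesLeftLog {E : Type*} [NormedAddCommGroup E] [NormedSpace ℝ E]
    {H : Type*} [TopologicalSpace H] [ChartedSpace E H] [Group H]
    (ξ : ℝ → GroupLieAlgebra 𝓘(ℝ, E) H) (s₀ : ℝ) (γ : ℝ → H) : Prop :=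
  MDifferentiable 𝓘(ℝ, ℝ) 𝓘(ℝ, E) γ ∧ (∀ s : ℝ, leftLogDeriv (E := E) γ s = ξ s) ∧ γ s₀ = 1

/-- `γ` is a solution of the initial value problem `γ(s)⁻¹ γ'(s) = ξ(s)`, `γ(s₀) = 1`, and it is
the only one. -/
def IsUniqueSolutionLeftLog {E : Type*} [NormedAddCommGroup E] [NormedSpace ℝ E]
    {H : Type*} [TopologicalSpace H] [ChartedSpace E H] [Group H]
    (ξ : ℝ → GroupLieAlgebra 𝓘(ℝ, E) H) (s₀ : ℝ) (γ : ℝ → H) : Prop :=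
  SolvesLeftLog (E := E) ξ s₀ γ ∧ ∀ γ' : ℝ → H, SolvesLeftLog (E := E) ξ s₀ γ' → γ' = γ

end HigherGauge

end

/-!
Differentiating the crossed multiplicativity of `Ψ` on the diagonal turns it into the equation
`Ψ⁻¹ ∂ₓΨ = ṁ(f⁻¹) η`, where `η = -ṁ(ϰ⁻¹) Γ_x` is the left logarithmic derivative of `Ψ` on the
diagonal. So `Ψ` is determined by `η`: two curves with the same left logarithmic derivative have a
constant quotient, because its velocity vanishes. Conversely, a smooth `η` gives a family of
solutions `L(x, y)` of the equation with `f = f(x, 0; y)` and `L(0, y) = 1`, and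
`Ψ(x', x; y) = m(f(x, 0; y))(L(x, y)⁻¹ L(x', y))` is crossed multiplicative with left logarithmic
derivative `η` on the diagonal. The same holds for `Φ` along `g`.

Solutions exist locally and depend smoothly on parameters because the integral curves of a smooth
vector field, rescaled to the time interval `[-1, 1]`, are the zeros of a smooth map on a Banach
space of continuous functions, to which the implicit function theorem applies. The equation is
invariant under left translations, so local solutions can be translated to match and glued, and no
blow-up occurs.
-/

noncomputable section

namespace HigherGauge

open Set Filter Topology Metric

section Superposition

/-- The pointwise application of a continuous family of operators to a continuous function. -/
def pointwiseApply (K E F : Type*) [TopologicalSpace K] [CompactSpace K]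
    [NormedAddCommGroup E] [NormedSpace ℝ E] [NormedAddCommGroup F] [NormedSpace ℝ F] :
    C(K, E →L[ℝ] F) →L[ℝ] C(K, E) →L[ℝ] C(K, F) :=
  LinearMap.mkContinuous₂
    (LinearMap.mk₂ ℝ
      (fun (A : C(K, E →L[ℝ] F)) (v : C(K, E)) => (⟨fun k => A k (v k), by fun_prop⟩ : C(K, F)))
      (fun _ _ _ => by ext; simp) (fun _ _ _ => by ext; simp)
      (fun _ _ _ => by ext; simp) (fun _ _ _ => by ext; simp)) 1
    (fun A v => by
      rw [one_mul, ContinuousMap.norm_le _ (by positivity)]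
      exact fun k => (A k).le_of_opNorm_le_of_le (A.norm_coe_le_norm k) (v.norm_coe_le_norm k))

variable {K : Type*} [TopologicalSpace K]

/-- The superposition (Nemytskii) operator `u ↦ f ∘ u` on continuous functions, with the junk value
`0` where `f ∘ u` is not continuous, so that `f` need only be regular on an open set. -/
def superposition {E F : Type*} [TopologicalSpace E] [TopologicalSpace F] [Zero F]
    (f : E → F) (u : C(K, E)) : C(K, F) :=
  ContinuousMap.mkD (f ∘ u) 0

lemma superposition_apply {E F : Type*} [TopologicalSpace E] [TopologicalSpace F] [Zero F]
    {f : E → F} {U : Set E} (hf : ContinuousOn f U) {u : C(K, E)} (hu : ∀ k, u k ∈ U) (k : K) :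
    superposition f u k = f (u k) :=
  ContinuousMap.mkD_apply_of_continuous (hf.comp_continuous u.continuous hu)

lemma superposition_comp {K' E F : Type*} [TopologicalSpace K'] [TopologicalSpace E]
    [TopologicalSpace F] [Zero F] {f : E → F} {U : Set E} (hf : ContinuousOn f U) {u : C(K, E)}
    (hu : ∀ k, u k ∈ U) (g : C(K', K)) :
    superposition f (u.comp g) = (superposition f u).comp g := by
  ext k
  exact (superposition_apply hf (fun k => hu (g k)) k).trans (superposition_apply hf hu (g k)).symm

lemma continuousOn_superposition {E F : Type*} [TopologicalSpace E] [TopologicalSpace F] [Zero F]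
    {f : E → F} {U : Set E} (hf : ContinuousOn f U) :
    ContinuousOn (superposition (K := K) f) {u | ∀ k, u k ∈ U} := by
  let incl : C(U, E) := ⟨Subtype.val, continuous_subtype_val⟩
  let fU : C(U, F) := ⟨U.domRestrict f, hf.domRestrict⟩
  let corestrict (u : {u : C(K, E) | ∀ k, u k ∈ U}) : C(K, U) :=
    ⟨fun k => ⟨u.1 k, u.2 k⟩, u.1.continuous.subtype_mk u.2⟩
  have corestrict_continuous : Continuous corestrict :=
    (ContinuousMap.isInducing_postcomp incl Topology.IsInducing.subtypeVal).continuous_iff.2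
      continuous_subtype_val
  refine continuousOn_iff_continuous_domRestrict.2
    (((ContinuousMap.continuous_postcomp fU).comp corestrict_continuous).congr fun u => ?_)
  ext k
  exact (superposition_apply hf u.2 k).symm

variable [CompactSpace K]

lemma isOpen_setOf_forall_mem {E : Type*} [TopologicalSpace E] {U : Set E} (hU : IsOpen U) :
    IsOpen {u : C(K, E) | ∀ k, u k ∈ U} := by
  simpa [MapsTo] using ContinuousMap.isOpen_setOfPred_mapsTo isCompact_univ hU

universe u

variable {E : Type u} [NormedAddCommGroup E] [NormedSpace ℝ E]

lemma hasFDerivAt_superposition {F : Type*} [NormedAddCommGroup F] [NormedSpace ℝ F]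
    {f : E → F} {f' : E → E →L[ℝ] F} {U : Set E} (hU : IsOpen U)
    (hf : ∀ x ∈ U, HasFDerivAt f (f' x) x) (hf' : ContinuousOn f' U)
    {u : C(K, E)} (hu : ∀ k, u k ∈ U) :
    HasFDerivAt (superposition f) (pointwiseApply K E F (superposition f' u)) u := by
  have hfc : ContinuousOn f U := fun x hx => (hf x hx).continuousAt.continuousWithinAt
  have hV := (isOpen_setOf_forall_mem (K := K) hU).mem_nhds hu
  rw [hasFDerivAt_iff_isLittleO, Asymptotics.isLittleO_iff]
  intro ε hε
  have f'_close : ∀ᶠ v in 𝓝 u, superposition f' v ∈ ball (superposition f' u) ε :=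
    ((continuousOn_superposition hf').continuousAt hV).eventually_mem
      (ball_mem_nhds (superposition f' u) hε)
  obtain ⟨δ, hδ, hball⟩ := Metric.eventually_nhds_iff_ball.1 (f'_close.and hV)
  filter_upwards [Metric.ball_mem_nhds u hδ] with v hv
  rw [ContinuousMap.norm_le _ (by positivity)]
  intro k
  have near : ∀ z ∈ ball (u k) δ, z ∈ U ∧ ‖f' z - f' (u k)‖ ≤ ε := by
    intro z hz
    let w : C(K, E) := u + ContinuousMap.const K (z - u k)
    have hwk : w k = z := by simp [w]
    have hw : w ∈ ball u δ := by
      rw [mem_ball, dist_eq_norm, add_sub_cancel_left]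
      exact (ContinuousMap.norm_lt_iff _ hδ).2 fun _ => by simpa [dist_eq_norm] using hz
    obtain ⟨hclose, hwU⟩ := hball w hw
    refine ⟨hwk ▸ hwU k, ?_⟩
    have := (ContinuousMap.dist_apply_le_dist k).trans (mem_ball.1 hclose).le
    rwa [superposition_apply hf' hwU, superposition_apply hf' hu, hwk, dist_eq_norm] at this
  have hvk : v k ∈ ball (u k) δ := (ContinuousMap.dist_apply_le_dist k).trans_lt hv
  have mean_value := (convex_ball (u k) δ).norm_image_sub_le_of_norm_hasFDerivWithin_le'
    (fun z hz => (hf z (near z hz).1).hasFDerivWithinAt) (fun z hz => (near z hz).2)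
    (mem_ball_self hδ) hvk
  calc ‖superposition f v k - superposition f u k - superposition f' u k (v k - u k)‖
      = ‖f (v k) - f (u k) - f' (u k) (v k - u k)‖ := by
        rw [superposition_apply hfc (hball v hv).2, superposition_apply hfc hu,
          superposition_apply hf' hu]
    _ ≤ ε * ‖v k - u k‖ := mean_value
    _ ≤ ε * ‖v - u‖ := by gcongr; exact (v - u).norm_coe_le_norm k

lemma contDiffOn_superposition (n : ℕ) {F : Type u} [NormedAddCommGroup F] [NormedSpace ℝ F]
    {f : E → F} {U : Set E} (hU : IsOpen U) (hf : ContDiffOn ℝ n f U) :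
    ContDiffOn ℝ n (superposition (K := K) f) {u | ∀ k, u k ∈ U} := by
  induction n generalizing F with
  | zero => exact contDiffOn_zero.2 (continuousOn_superposition hf.continuousOn)
  | succ n ih =>
    rw [Nat.cast_add_one] at hf ⊢
    obtain ⟨hd, -, hf'⟩ := (contDiffOn_succ_iff_fderiv_of_isOpen hU).1 hf
    have deriv_superposition {u : C(K, E)} (hu : ∀ k, u k ∈ U) :=
      hasFDerivAt_superposition hU
        (fun x hx => (hd.differentiableAt (hU.mem_nhds hx)).hasFDerivAt) hf'.continuousOn hu
    refine (contDiffOn_succ_iff_fderiv_of_isOpen (isOpen_setOf_forall_mem hU)).2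
      ⟨fun u hu => (deriv_superposition hu).differentiableAt.differentiableWithinAt, by simp, ?_⟩
    have smooth : ContDiffOn ℝ n (fun u => pointwiseApply K E F (superposition (fderiv ℝ f) u))
        {u | ∀ k, u k ∈ U} :=
      ContDiff.comp_contDiffOn (g := pointwiseApply K E F)
        (ContinuousLinearMap.contDiff _) (ih hf')
    exact smooth.congr fun u hu => (deriv_superposition hu).fderiv

end Superposition

section Flow

/-- The interval on which rescaled integral curves are defined. -/
abbrev timeInterval : Set ℝ := Icc (-1) 1

lemma div_mem_timeInterval {t ε : ℝ} (ht : |t| < ε) : t / ε ∈ timeInterval := by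
  have hε : 0 < ε := (abs_nonneg t).trans_lt ht
  rw [mem_Icc, ← abs_le, abs_div, abs_of_pos hε, div_le_one hε]
  exact ht.le

/-- Multiplication of times by `ρ ∈ [-1, 1]`. -/
def scaleTime (ρ : timeInterval) : C(timeInterval, timeInterval) :=
  ⟨fun s => ⟨ρ * s, abs_le.1 <| by
    rw [abs_mul]
    exact mul_le_one₀ (abs_le.2 ρ.2) (abs_nonneg _) (abs_le.2 s.2)⟩, by fun_prop⟩

lemma coe_scaleTime (ρ s : timeInterval) : (scaleTime ρ s : ℝ) = ρ * s := rfl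

lemma scaleTime_one (ρ : timeInterval) : scaleTime ρ ⟨1, by norm_num⟩ = ρ :=
  Subtype.ext (mul_one _)

lemma dist_scaleTime_le {E : Type*} [PseudoMetricSpace E] (p₀ p : E) (t : ℝ)
    (u : C(timeInterval, E)) (ρ : timeInterval) :
    dist ((p, ρ * t), u.comp (scaleTime ρ)) ((p₀, 0), ContinuousMap.const timeInterval p₀) ≤
      dist ((p, t), u) ((p₀, 0), ContinuousMap.const timeInterval p₀) := by
  have time_le : dist (ρ * t) 0 ≤ dist t 0 := by
    simpa [abs_mul] using mul_le_of_le_one_left (abs_nonneg t) (abs_le.2 ρ.2)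
  have curve_le : dist (u.comp (scaleTime ρ)) (ContinuousMap.const timeInterval p₀) ≤
      dist u (ContinuousMap.const timeInterval p₀) :=
    (ContinuousMap.dist_le dist_nonneg).2 fun s =>
      ContinuousMap.dist_apply_le_dist (g := ContinuousMap.const timeInterval p₀) (scaleTime ρ s)
  exact max_le_max (max_le_max le_rfl time_le) curve_le

/-- The extension of a function on `[-1, 1]` to the real line that is constant outside. -/
def extendTime {E : Type*} (u : timeInterval → E) : ℝ → E := IccExtend (by norm_num) u

lemma extendTime_coe {E : Type*} (u : timeInterval → E) (s : timeInterval) :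
    extendTime u s = u s :=
  IccExtend_val _ _ s

lemma continuous_extendTime {E : Type*} [TopologicalSpace E] (u : C(timeInterval, E)) :
    Continuous (extendTime u) :=
  u.continuous.Icc_extend'

/-- The primitive vanishing at `0` of continuous functions on `[-1, 1]`. -/
def primitive (E : Type*) [NormedAddCommGroup E] [NormedSpace ℝ E] :
    C(timeInterval, E) →L[ℝ] C(timeInterval, E) :=
  have integrable (u : C(timeInterval, E)) (s : ℝ) :=
    (continuous_extendTime u).intervalIntegrable (μ := MeasureTheory.volume) 0 s
  LinearMap.mkContinuous
    { toFun := fun u => ⟨fun s => ∫ σ in (0 : ℝ)..s, extendTime u σ,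
        (intervalIntegral.continuous_primitive
          (continuous_extendTime u).intervalIntegrable 0).comp continuous_subtype_val⟩
      map_add' := fun u v => by
        ext s
        exact intervalIntegral.integral_add (integrable u s) (integrable v s)
      map_smul' := fun c u => by
        ext s
        exact intervalIntegral.integral_smul c (extendTime u) } 1
    (fun u => by
      rw [ContinuousMap.norm_le _ (by positivity)]
      intro s
      calc ‖∫ σ in (0 : ℝ)..s, extendTime u σ‖ ≤ ‖u‖ * |(s : ℝ) - 0| :=
            intervalIntegral.norm_integral_le_of_norm_le_const fun _ _ => u.norm_coe_le_norm _
        _ ≤ 1 * ‖u‖ := by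
            rw [sub_zero, one_mul]
            exact mul_le_of_le_one_right (norm_nonneg _) (abs_le.2 s.2))

section

variable {E : Type*} [NormedAddCommGroup E] [NormedSpace ℝ E]

lemma primitive_apply (u : C(timeInterval, E)) (s : timeInterval) :
    primitive E u s = ∫ σ in (0 : ℝ)..s, extendTime u σ := rfl

lemma primitive_scaleTime_apply (u : C(timeInterval, E)) (ρ s : timeInterval) :
    primitive E u (scaleTime ρ s) = (ρ : ℝ) • primitive E (u.comp (scaleTime ρ)) s := by
  have extend_comp : EqOn (extendTime (u.comp (scaleTime ρ))) (fun σ => extendTime u (ρ * σ))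
      (uIcc 0 (s : ℝ)) := by
    intro σ hσ
    lift σ to timeInterval using ordConnected_Icc.uIcc_subset (by norm_num) s.2 hσ
    simp only [← coe_scaleTime, extendTime_coe, ContinuousMap.comp_apply]
  simp only [primitive_apply, coe_scaleTime]
  rw [intervalIntegral.integral_congr extend_comp, intervalIntegral.smul_integral_comp_mul_left,
    mul_zero]

/-- The curve `u` on `[-1, 1]` solves `u' = t (f ∘ u)`, `u 0 = p` exactly when this function
vanishes at `((p, t), u)`; then `s ↦ u (s / t)` is an integral curve of `f`. -/
def flowEquation (f : E → E) (z : (E × ℝ) × C(timeInterval, E)) : C(timeInterval, E) :=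
  z.2 - ContinuousMap.const timeInterval z.1.1 - z.1.2 • primitive E (superposition f z.2)

lemma flowEquation_eq_zero_iff {f : E → E} {q : E × ℝ} {u : C(timeInterval, E)} :
    flowEquation f (q, u) = 0 ↔
      ∀ s, u s = q.1 + q.2 • primitive E (superposition f u) s := by
  rw [flowEquation, sub_sub, sub_eq_zero, ContinuousMap.ext_iff]
  rfl

lemma flowEquation_scaleTime {f : E → E} {U : Set E} (hf : ContinuousOn f U) {p : E} {t : ℝ}
    {u : C(timeInterval, E)} (hu : ∀ s, u s ∈ U) (h : flowEquation f ((p, t), u) = 0)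
    (ρ : timeInterval) : flowEquation f ((p, ρ * t), u.comp (scaleTime ρ)) = 0 := by
  rw [flowEquation_eq_zero_iff] at h ⊢
  intro s
  rw [superposition_comp hf hu, mul_comm, ← smul_smul, ← primitive_scaleTime_apply]
  exact h (scaleTime ρ s)

lemma hasDerivAt_of_flowEquation_eq_zero [CompleteSpace E] {f : E → E} {U : Set E}
    (hf : ContinuousOn f U) {p : E} {ε : ℝ} (hε : 0 < ε) {u : C(timeInterval, E)}
    (hu : ∀ s, u s ∈ U) (h : flowEquation f ((p, ε), u) = 0) {t : ℝ} (ht : |t| < ε) :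
    HasDerivAt (fun t => extendTime u (t / ε)) (f (extendTime u (t / ε))) t := by
  have integral_form : (fun t => extendTime u (t / ε)) =ᶠ[𝓝 t] fun t =>
      p + ε • ∫ σ in (0 : ℝ)..(t / ε), extendTime (superposition f u) σ := by
    filter_upwards [continuous_abs.continuousAt.eventually_lt_const ht] with t ht
    obtain ⟨s, hs⟩ : ∃ s : timeInterval, s = t / ε := ⟨⟨_, div_mem_timeInterval ht⟩, rfl⟩
    rw [← hs, extendTime_coe]
    exact flowEquation_eq_zero_iff.1 h s
  have velocity : ε • ((1 / ε) • extendTime (superposition f u) (t / ε)) =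
      f (extendTime u (t / ε)) := by
    rw [smul_smul, mul_one_div_cancel hε.ne', one_smul]
    exact superposition_apply hf hu _
  have primitive_deriv : HasDerivAt (fun s => ∫ σ in (0 : ℝ)..s, extendTime (superposition f u) σ)
      (extendTime (superposition f u) (t / ε)) (t / ε) :=
    (continuous_extendTime (superposition f u)).integral_hasStrictDerivAt 0 _ |>.hasDerivAt
  have integral_deriv := ((primitive_deriv.scomp t
    ((hasDerivAt_id t).div_const ε)).const_smul ε).const_add p
  rw [velocity] at integral_deriv
  exact integral_deriv.congr_of_eventuallyEq integral_form

lemma extendTime_zero_of_flowEquation_eq_zero {f : E → E} {q : E × ℝ} {u : C(timeInterval, E)}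
    (h : flowEquation f (q, u) = 0) : extendTime u 0 = q.1 := by
  have initial := flowEquation_eq_zero_iff.1 h ⟨0, by norm_num⟩
  rw [primitive_apply, intervalIntegral.integral_same, smul_zero, add_zero] at initial
  exact (extendTime_coe u ⟨0, by norm_num⟩).trans initial

end

universe u

variable {E : Type u} [NormedAddCommGroup E] [NormedSpace ℝ E]

lemma contDiffAt_flowEquation {n : ℕ} {f : E → E} {U : Set E} (hU : IsOpen U)
    (hf : ContDiffOn ℝ n f U) {z : (E × ℝ) × C(timeInterval, E)} (hz : ∀ s, z.2 s ∈ U) :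
    ContDiffAt ℝ n (flowEquation f) z := by
  have superposition_smooth : ContDiffAt ℝ n (fun z : (E × ℝ) × C(timeInterval, E) =>
      superposition f z.2) z :=
    ((contDiffOn_superposition n hU hf).contDiffAt
      ((isOpen_setOf_forall_mem hU).mem_nhds hz)).comp z contDiffAt_snd
  have const_smooth : ContDiff ℝ n (ContinuousMap.const timeInterval : E → C(timeInterval, E)) :=
    (ContinuousLinearMap.const ℝ timeInterval : E →L[ℝ] C(timeInterval, E)).contDiff
  unfold flowEquation
  fun_prop

/-- At time `0` the flow equation reads `u = const p`, whatever the vector field. -/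
lemma fderiv_flowEquation_comp_inr {f : E → E} {p : E} {u : C(timeInterval, E)}
    (h : DifferentiableAt ℝ (flowEquation f) ((p, 0), u)) :
    fderiv ℝ (flowEquation f) ((p, 0), u) ∘L .inr ℝ (E × ℝ) C(timeInterval, E) =
      .id ℝ C(timeInterval, E) := by
  have partial_deriv := HasFDerivAt.comp u h.hasFDerivAt (hasFDerivAt_prodMk_right (p, 0) u)
  have partial_eq : flowEquation f ∘ Prod.mk (p, 0) =
      fun v => v - ContinuousMap.const timeInterval p := by
    ext v : 1
    simp [flowEquation]
  rw [partial_eq] at partial_deriv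
  exact partial_deriv.unique ((hasFDerivAt_id u).sub_const _)

variable [CompleteSpace E]

lemma exists_flowEquation_eq_zero {n : ℕ} (hn : n ≠ 0) {f : E → E} {U : Set E} (hU : IsOpen U)
    (hf : ContDiffOn ℝ n f U) {p₀ : E} (hp₀ : p₀ ∈ U) :
    ∃ ψ : E × ℝ → C(timeInterval, E), ContDiffAt ℝ n ψ (p₀, 0) ∧
      ψ (p₀, 0) = ContinuousMap.const timeInterval p₀ ∧
      (∀ᶠ q in 𝓝 (p₀, (0 : ℝ)), flowEquation f (q, ψ q) = 0) ∧
      ∀ᶠ z in 𝓝 ((p₀, (0 : ℝ)), ContinuousMap.const timeInterval p₀),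
        flowEquation f z = 0 → ψ z.1 = z.2 := by
  let z₀ : (E × ℝ) × C(timeInterval, E) := ((p₀, 0), ContinuousMap.const timeInterval p₀)
  have smooth : ContDiffAt ℝ n (flowEquation f) z₀ := contDiffAt_flowEquation hU hf fun _ => hp₀
  have hn' : (n : ℕ∞ω) ≠ 0 := by exact_mod_cast hn
  have invertible : (fderiv ℝ (flowEquation f) z₀ ∘L
      .inr ℝ (E × ℝ) C(timeInterval, E)).IsInvertible := by
    rw [fderiv_flowEquation_comp_inr (smooth.differentiableAt hn')]
    exact ⟨.refl ℝ _, rfl⟩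
  have zero_at : flowEquation f z₀ = 0 := by simp [flowEquation, z₀]
  refine ⟨smooth.implicitFunction hn' invertible,
    smooth.contDiffAt_implicitFunction hn' invertible,
    smooth.implicitFunction_apply_self hn' invertible, ?_, ?_⟩
  · simpa only [zero_at] using smooth.eventually_apply_implicitFunction hn' invertible
  · filter_upwards [smooth.eventually_apply_eq_iff_implicitFunction hn' invertible] with z hz h
    exact hz.1 (h.trans zero_at.symm)

lemma exists_scaling_flowEquation {n : ℕ} (hn : n ≠ 0) {f : E → E} {U : Set E} (hU : IsOpen U)
    (hf : ContDiffOn ℝ n f U) {p₀ : E} (hp₀ : p₀ ∈ U) :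
    ∃ ψ : E × ℝ → C(timeInterval, E), ContDiffAt ℝ n ψ (p₀, 0) ∧
      ∀ᶠ q in 𝓝 (p₀, (0 : ℝ)), flowEquation f (q, ψ q) = 0 ∧ (∀ s, ψ q s ∈ U) ∧
        ∀ ρ : timeInterval, ψ (q.1, ρ * q.2) = (ψ q).comp (scaleTime ρ) := by
  obtain ⟨ψ, smooth, ψ_zero, solves, unique⟩ := exists_flowEquation_eq_zero hn hU hf hp₀
  refine ⟨ψ, smooth, ?_⟩
  let z₀ : (E × ℝ) × C(timeInterval, E) := ((p₀, 0), ContinuousMap.const timeInterval p₀)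
  have graph_tendsto : Tendsto (fun q => (q, ψ q)) (𝓝 (p₀, 0)) (𝓝 z₀) := by
    have := (continuousAt_id.prodMk smooth.continuousAt).tendsto
    simpa only [z₀, ψ_zero, id] using this
  obtain ⟨r, hr, unique⟩ := Metric.eventually_nhds_iff_ball.1 unique
  have curve_mem : ∀ᶠ q in 𝓝 (p₀, (0 : ℝ)), ∀ s, ψ q s ∈ U :=
    smooth.continuousAt.eventually_mem
      ((isOpen_setOf_forall_mem hU).mem_nhds (by rw [ψ_zero]; exact fun _ => hp₀))
  filter_upwards [solves, curve_mem, graph_tendsto.eventually_mem (ball_mem_nhds z₀ hr)]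
    with q hq hU hball
  exact ⟨hq, hU, fun ρ => unique _ ((dist_scaleTime_le p₀ _ _ _ ρ).trans_lt hball)
    (flowEquation_scaleTime hf.continuousOn hU hq ρ)⟩

theorem exists_contDiffAt_localFlow {n : ℕ} (hn : n ≠ 0) {f : E → E} {p₀ : E}
    (hf : ContDiffAt ℝ n f p₀) :
    ∃ φ : E × ℝ → E, ContDiffAt ℝ n φ (p₀, 0) ∧ ∀ᶠ q in 𝓝 (p₀, (0 : ℝ)),
      φ (q.1, 0) = q.1 ∧ HasDerivAt (fun t => φ (q.1, t)) (f (φ q)) q.2 := by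
  obtain ⟨U, hU, hp₀, hfU⟩ : ∃ U, IsOpen U ∧ p₀ ∈ U ∧ ContDiffOn ℝ n f U := by
    obtain ⟨U, smooth, hU, hp₀⟩ := _root_.eventually_nhds_iff.1 (hf.eventually (by simp))
    exact ⟨U, hU, hp₀, fun x hx => (smooth x hx).contDiffWithinAt⟩
  obtain ⟨ψ, smooth, solves⟩ := exists_scaling_flowEquation hn hU hfU hp₀
  let one : timeInterval := ⟨1, by norm_num⟩
  obtain ⟨Good, hGood, SmallTime, hSmall, good⟩ := eventually_prod_iff.1
    ((nhds_prod_eq (x := p₀) (y := (0 : ℝ))) ▸ solves)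
  obtain ⟨ε, hε_small, hε⟩ := ((hSmall.filter_mono nhdsWithin_le_nhds).and
    (self_mem_nhdsWithin : Ioi (0 : ℝ) ∈ 𝓝[>] 0)).exists
  have eval_smooth : ContDiff ℝ n fun u : C(timeInterval, E) => u one :=
    (ContinuousMap.evalCLM ℝ one : C(timeInterval, E) →L[ℝ] E).contDiff
  refine ⟨fun q => ψ q one, eval_smooth.contDiffAt.comp _ smooth, ?_⟩
  have small_time : ∀ᶠ t in 𝓝 (0 : ℝ), |t| < ε :=
    continuous_abs.continuousAt.eventually_lt_const (by simpa using hε)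
  rw [nhds_prod_eq]
  filter_upwards [hGood.prod_mk small_time] with ⟨p, t⟩ ⟨hp, ht⟩
  obtain ⟨solves, mem, scaling⟩ := good hp hε_small
  have flow_eq {t : ℝ} (ht : |t| < ε) : ψ (p, t) one = extendTime (ψ (p, ε)) (t / ε) := by
    let ρ : timeInterval := ⟨t / ε, div_mem_timeInterval ht⟩
    have := scaling ρ
    rw [div_mul_cancel₀ t hε.ne'] at this
    rw [this, ContinuousMap.comp_apply, scaleTime_one]
    exact (extendTime_coe _ ρ).symm
  refine ⟨?_, ?_⟩
  · rw [flow_eq (by simpa using hε), zero_div]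
    exact extendTime_zero_of_flowEquation_eq_zero (q := (p, ε)) solves
  · rw [flow_eq ht]
    have curve_deriv := hasDerivAt_of_flowEquation_eq_zero hfU.continuousOn hε mem solves ht
    exact curve_deriv.congr_of_eventuallyEq
      ((continuous_abs.continuousAt.eventually_lt_const ht).mono fun _ => flow_eq)

end Flow

section LogarithmicDerivative

variable {E : Type*} [NormedAddCommGroup E] [NormedSpace ℝ E]

/-- All tangent spaces of a manifold modelled on `E` are definitionally `E`, so the differential of
`g` may be taken at a point `x` that is only propositionally equal to `γ s`. -/
lemma hasMFDerivAt_comp_curve {F M N : Type*} [NormedAddCommGroup F] [NormedSpace ℝ F]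
    [TopologicalSpace M] [ChartedSpace E M] [TopologicalSpace N] [ChartedSpace F N]
    {g : M → N} {x : M} {γ : ℝ → M} {s : ℝ} {v : E} (hg : MDifferentiableAt 𝓘(ℝ, E) 𝓘(ℝ, F) g x)
    (hγ : HasMFDerivAt 𝓘(ℝ, ℝ) 𝓘(ℝ, E) γ s (ContinuousLinearMap.toSpanSingleton ℝ v))
    (hx : γ s = x) :
    HasMFDerivAt 𝓘(ℝ, ℝ) 𝓘(ℝ, F) (fun s => g (γ s)) s
      (ContinuousLinearMap.toSpanSingleton ℝ
        ((mfderiv 𝓘(ℝ, E) 𝓘(ℝ, F) g x : E →L[ℝ] F) v)) := by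
  subst hx
  have comp_eq (A : E →L[ℝ] F) := A.comp_toSpanSingleton v
  exact (hg.hasMFDerivAt.comp s hγ).congr_mfderiv (comp_eq _)

section ZeroDerivative

variable {F M : Type*} [NormedAddCommGroup F] [NormedSpace ℝ F]
  [TopologicalSpace M] [ChartedSpace E M] [IsManifold 𝓘(ℝ, E) 1 M] {δ : F → M} {a : F}

lemma eventually_eq_of_hasMFDerivAt_zero
    (h : ∀ᶠ x in 𝓝 a, HasMFDerivAt 𝓘(ℝ, F) 𝓘(ℝ, E) δ x (0 : F →L[ℝ] E)) :
    ∀ᶠ x in 𝓝 a, δ x = δ a := by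
  let chart := extChartAt 𝓘(ℝ, E) (δ a)
  obtain ⟨r, hr, hball⟩ := Metric.eventually_nhds_iff_ball.1 (h.and
    (h.self_of_nhds.continuousAt.eventually_mem (extChartAt_source_mem_nhds (I := 𝓘(ℝ, E)) (δ a))))
  have chart_deriv : ∀ x ∈ ball a r, HasFDerivAt (fun x => chart (δ x)) (0 : F →L[ℝ] E) x := by
    intro x hx
    obtain ⟨hδ, hsource⟩ := hball x hx
    rw [extChartAt_source] at hsource
    exact ((mdifferentiableAt_extChartAt hsource).hasMFDerivAt.comp x hδ |>.congr_mfderiv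
      (ContinuousLinearMap.comp_zero _)).hasFDerivAt
  filter_upwards [ball_mem_nhds a hr] with x hx
  refine chart.injOn (hball x hx).2 (hball a (mem_ball_self hr)).2 ?_
  exact isOpen_ball.is_const_of_fderiv_eq_zero (𝕜 := ℝ) (convex_ball a r).isPreconnected
    (fun y hy => (chart_deriv y hy).differentiableAt.differentiableWithinAt)
    (fun y hy => (chart_deriv y hy).fderiv) hx (mem_ball_self hr)

lemma eqOn_const_of_hasMFDerivAt_zero {I : Set F} (hI : IsOpen I) (hIc : IsPreconnected I)
    (h : ∀ x ∈ I, HasMFDerivAt 𝓘(ℝ, F) 𝓘(ℝ, E) δ x (0 : F →L[ℝ] E)) (ha : a ∈ I) :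
    EqOn δ (fun _ => δ a) I := by
  intro x hx
  refine hIc.induction₂ (fun a x => δ x = δ a) (fun a ha => ?_)
    (fun _ _ _ _ _ _ h₁ h₂ => h₂.trans h₁) (fun _ _ _ _ h => h.symm) ha hx
  exact mem_nhdsWithin_of_mem_nhds
    (eventually_eq_of_hasMFDerivAt_zero ((hI.eventually_mem ha).mono h))

end ZeroDerivative

/-- When all maps `f p` send `x` to the same point, their differentials at `x` are linear maps
between fixed tangent spaces, and no coordinate changes enter. -/
lemma contDiff_mfderiv_of_forall_eq {P F M N : Type*} [NormedAddCommGroup P] [NormedSpace ℝ P]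
    [NormedAddCommGroup F] [NormedSpace ℝ F] [TopologicalSpace M] [ChartedSpace E M]
    [IsManifold 𝓘(ℝ, E) 1 M] [TopologicalSpace N] [ChartedSpace F N] [IsManifold 𝓘(ℝ, F) 1 N]
    {f : P → M → N} {x : M} {y : N}
    (hf : ContMDiff (𝓘(ℝ, P).prod 𝓘(ℝ, E)) 𝓘(ℝ, F) ∞ (Function.uncurry f))
    (hy : ∀ p, f p x = y) :
    ContDiff ℝ ∞ (F := E →L[ℝ] F) (fun p => mfderiv 𝓘(ℝ, E) 𝓘(ℝ, F) (f p) x) := by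
  refine contMDiff_iff_contDiff.1 fun p₀ => ?_
  have := ContMDiffAt.mfderiv f (fun _ => x) (hf (p₀, x)) contMDiffAt_const (m := ∞) (by simp)
  refine this.congr_of_eventuallyEq (.of_forall fun p => ?_)
  refine Eq.trans ?_ (inTangentCoordinates_eq (fun _ => x) (fun p => f p x) _
    (mem_chart_source E x) (by simpa only [hy] using mem_chart_source F y)).symm
  rw [hy, hy]
  refine ContinuousLinearMap.ext fun v => Eq.symm ?_
  refine (tangentCoordChange_self (mem_extChartAt_source (I := 𝓘(ℝ, F)) y)).trans ?_
  exact congrArg (mfderiv 𝓘(ℝ, E) 𝓘(ℝ, F) (f p) x)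
    (tangentCoordChange_self (E := E) (mem_extChartAt_source (I := 𝓘(ℝ, E)) x))

variable {H : Type*} [TopologicalSpace H] [ChartedSpace E H] [Group H]

lemma leftLogDeriv_congr {γ γ' : ℝ → H} {s : ℝ} (h : γ =ᶠ[𝓝 s] γ') :
    leftLogDeriv (E := E) γ s = leftLogDeriv (E := E) γ' s := by
  unfold leftLogDeriv
  rw [h.mfderiv_eq, h.eq_of_nhds]

variable [LieGroup 𝓘(ℝ, E) ∞ H]

lemma mdifferentiable_mul_left (a : H) :
    MDifferentiable 𝓘(ℝ, E) 𝓘(ℝ, E) (fun h : H => a * h) :=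
  (contMDiff_mul_left (n := ∞)).mdifferentiable (by simp)

lemma hasMFDerivAt_inv_mul {γ : ℝ → H} {s : ℝ} (hγ : MDifferentiableAt 𝓘(ℝ, ℝ) 𝓘(ℝ, E) γ s) :
    HasMFDerivAt 𝓘(ℝ, ℝ) 𝓘(ℝ, E) (fun s' => (γ s)⁻¹ * γ s') s
      (ContinuousLinearMap.toSpanSingleton ℝ (leftLogDeriv (E := E) γ s : E)) :=
  (((mdifferentiable_mul_left (E := E) (γ s)⁻¹ (γ s)).hasMFDerivAt.comp s hγ.hasMFDerivAt)
    ).congr_mfderiv (ContinuousLinearMap.ext_ring (one_smul ℝ _).symm)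

lemma leftLogDeriv_eq_of_hasMFDerivAt {γ : ℝ → H} {s : ℝ} {v : E}
    (hγ : MDifferentiableAt 𝓘(ℝ, ℝ) 𝓘(ℝ, E) γ s)
    (h : HasMFDerivAt 𝓘(ℝ, ℝ) 𝓘(ℝ, E) (fun s' => (γ s)⁻¹ * γ s') s
      (ContinuousLinearMap.toSpanSingleton ℝ v)) :
    leftLogDeriv (E := E) γ s = v := by
  have span_eq : ContinuousLinearMap.toSpanSingleton ℝ (leftLogDeriv (E := E) γ s : E) =
      ContinuousLinearMap.toSpanSingleton ℝ v :=
    hasMFDerivAt_unique (f := fun s' => (γ s)⁻¹ * γ s') (hasMFDerivAt_inv_mul hγ) h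
  have at_one := congrArg (fun A : ℝ →L[ℝ] E => A 1) span_eq
  exact (one_smul ℝ _).symm.trans (at_one.trans (one_smul ℝ v))

lemma leftLogDeriv_mul_left (a : H) {γ : ℝ → H} {s : ℝ}
    (hγ : MDifferentiableAt 𝓘(ℝ, ℝ) 𝓘(ℝ, E) γ s) :
    leftLogDeriv (E := E) (fun s => a * γ s) s = leftLogDeriv (E := E) γ s := by
  refine leftLogDeriv_eq_of_hasMFDerivAt ((mdifferentiable_mul_left a _).comp s hγ) ?_
  exact (hasMFDerivAt_inv_mul hγ).congr_of_eventuallyEq (.of_forall fun s' => by group)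

lemma leftLogDeriv_map {E' H' : Type*} [NormedAddCommGroup E'] [NormedSpace ℝ E']
    [TopologicalSpace H'] [ChartedSpace E' H'] [Group H'] [LieGroup 𝓘(ℝ, E') ∞ H']
    {φ : H →* H'} (hφ : MDifferentiable 𝓘(ℝ, E) 𝓘(ℝ, E') φ) {γ : ℝ → H} {s : ℝ}
    (hγ : MDifferentiableAt 𝓘(ℝ, ℝ) 𝓘(ℝ, E) γ s) :
    leftLogDeriv (E := E') (fun s => φ (γ s)) s =
      (mfderiv 𝓘(ℝ, E) 𝓘(ℝ, E') φ 1 : E →L[ℝ] E') (leftLogDeriv (E := E) γ s) := by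
  refine leftLogDeriv_eq_of_hasMFDerivAt ((hφ _).comp s hγ) ?_
  exact (hasMFDerivAt_comp_curve (hφ 1) (hasMFDerivAt_inv_mul hγ) (inv_mul_cancel _)
    ).congr_of_eventuallyEq (.of_forall fun s' => by simp)

lemma hasMFDerivAt_of_leftLogDeriv {γ : ℝ → H} {s : ℝ}
    (hγ : MDifferentiableAt 𝓘(ℝ, ℝ) 𝓘(ℝ, E) γ s) :
    HasMFDerivAt 𝓘(ℝ, ℝ) 𝓘(ℝ, E) γ s (ContinuousLinearMap.toSpanSingleton ℝ
      ((mfderiv 𝓘(ℝ, E) 𝓘(ℝ, E) (fun h : H => γ s * h) 1 : E →L[ℝ] E)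
        (leftLogDeriv (E := E) γ s))) :=
  (hasMFDerivAt_comp_curve (mdifferentiable_mul_left (γ s) 1) (hasMFDerivAt_inv_mul hγ)
    (inv_mul_cancel _)).congr_of_eventuallyEq (.of_forall fun s' => by simp)

/-- If `ξ` is the common logarithmic derivative, the velocity of `γ / δ` at `s` is the derivative
at `1` in the direction `ξ` of the constant map `h ↦ γ(s) h / (δ(s) h)`. -/
lemma hasMFDerivAt_div_zero {γ δ : ℝ → H} {s : ℝ}
    (hγ : MDifferentiableAt 𝓘(ℝ, ℝ) 𝓘(ℝ, E) γ s) (hδ : MDifferentiableAt 𝓘(ℝ, ℝ) 𝓘(ℝ, E) δ s)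
    (h : leftLogDeriv (E := E) γ s = leftLogDeriv (E := E) δ s) :
    HasMFDerivAt 𝓘(ℝ, ℝ) 𝓘(ℝ, E) (fun s => γ s / δ s) s (0 : ℝ →L[ℝ] E) := by
  let quotient : H × H → H := fun p => p.1 / p.2
  have quotient_diff : MDifferentiable (𝓘(ℝ, E).prod 𝓘(ℝ, E)) 𝓘(ℝ, E) quotient :=
    (ContMDiff.div contMDiff_fst contMDiff_snd : ContMDiff _ _ ∞ quotient).mdifferentiable (by simp)
  obtain ⟨D, quotient_deriv⟩ : ∃ D : E × E →L[ℝ] E, ∀ p, p = (γ s, δ s) →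
      HasMFDerivAt (𝓘(ℝ, E).prod 𝓘(ℝ, E)) 𝓘(ℝ, E) quotient p D :=
    ⟨mfderiv (𝓘(ℝ, E).prod 𝓘(ℝ, E)) 𝓘(ℝ, E) quotient (γ s, δ s), by
      rintro _ rfl; exact (quotient_diff _).hasMFDerivAt⟩
  let translate (a : H) : E →L[ℝ] E := mfderiv 𝓘(ℝ, E) 𝓘(ℝ, E) (fun h : H => a * h) 1
  have translate_deriv (a : H) : HasMFDerivAt 𝓘(ℝ, E) 𝓘(ℝ, E) (fun h : H => a * h) 1
    (translate a) := (mdifferentiable_mul_left a 1).hasMFDerivAt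
  have diagonal_deriv : D.comp ((translate (γ s)).prod (translate (δ s))) = 0 := by
    have := (quotient_deriv (γ s * 1, δ s * 1) (by simp)).comp 1
      ((translate_deriv (γ s)).prodMk (translate_deriv (δ s)))
    refine hasMFDerivAt_unique this ?_
    have constant : quotient ∘ (fun h => (γ s * h, δ s * h)) = fun _ => γ s / δ s :=
      funext fun h => mul_div_mul_right_eq_div _ _ _
    rw [constant]
    exact hasMFDerivAt_const _ _
  refine ((quotient_deriv _ rfl).comp s ((hasMFDerivAt_of_leftLogDeriv hγ).prodMk
    (hasMFDerivAt_of_leftLogDeriv hδ))).congr_mfderiv (ContinuousLinearMap.ext_ring ?_)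
  rw [← h]
  refine Eq.trans ?_ (DFunLike.congr_fun diagonal_deriv (leftLogDeriv (E := E) γ s))
  exact congrArg D (Prod.ext (one_smul ℝ _) (one_smul ℝ _))

lemma eqOn_mul_of_leftLogDeriv_eq {γ γ' : ℝ → H} {I : Set ℝ} (hI : IsOpen I)
    (hIc : IsPreconnected I)
    (hγ : ∀ s ∈ I, MDifferentiableAt 𝓘(ℝ, ℝ) 𝓘(ℝ, E) γ s)
    (hγ' : ∀ s ∈ I, MDifferentiableAt 𝓘(ℝ, ℝ) 𝓘(ℝ, E) γ' s)
    (h : ∀ s ∈ I, leftLogDeriv (E := E) γ s = leftLogDeriv (E := E) γ' s)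
    {s₀ : ℝ} (hs₀ : s₀ ∈ I) : EqOn γ (fun s => γ s₀ / γ' s₀ * γ' s) I := by
  have : IsManifold 𝓘(ℝ, E) 1 H := IsManifold.of_le (n := ∞) (by simp)
  intro s hs
  rw [← div_eq_iff_eq_mul]
  exact eqOn_const_of_hasMFDerivAt_zero hI hIc
    (fun s hs => hasMFDerivAt_div_zero (hγ s hs) (hγ' s hs) (h s hs)) hs₀ hs

lemma SolvesLeftLog.unique {ξ : ℝ → GroupLieAlgebra 𝓘(ℝ, E) H} {s₀ : ℝ} {γ γ' : ℝ → H}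
    (h : SolvesLeftLog (E := E) ξ s₀ γ) (h' : SolvesLeftLog (E := E) ξ s₀ γ') : γ = γ' := by
  obtain ⟨hγ, hξ, initial⟩ := h
  obtain ⟨hγ', hξ', initial'⟩ := h'
  have := eqOn_mul_of_leftLogDeriv_eq isOpen_univ isPreconnected_univ (fun s _ => hγ s)
    (fun s _ => hγ' s) (fun s _ => (hξ s).trans (hξ' s).symm) (mem_univ s₀)
  funext s
  simpa [initial, initial'] using this (mem_univ s)

lemma leftLogDeriv_eq_mfderiv_translate {γ : ℝ → H} {s : ℝ}
    (hγ : MDifferentiableAt 𝓘(ℝ, ℝ) 𝓘(ℝ, E) γ s) :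
    leftLogDeriv (E := E) γ s =
      (mfderiv 𝓘(ℝ, ℝ) 𝓘(ℝ, E) (fun t => (γ s)⁻¹ * γ (s + t)) 0 : ℝ →L[ℝ] E) 1 := by
  have shift : HasMFDerivAt 𝓘(ℝ, ℝ) 𝓘(ℝ, ℝ) (fun t => s + t) 0
      (ContinuousLinearMap.toSpanSingleton ℝ (1 : ℝ)) :=
    ((hasDerivAt_id (0 : ℝ)).const_add s).hasFDerivAt.hasMFDerivAt
  have translated := hasMFDerivAt_inv_mul hγ
  rw [(hasMFDerivAt_comp_curve translated.mdifferentiableAt shift (add_zero s)).mfderiv,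
    translated.mfderiv]
  exact ((one_smul ℝ _).trans (one_smul ℝ _)).symm

lemma contDiff_leftLogDeriv {P : Type*} [NormedAddCommGroup P] [NormedSpace ℝ P]
    {γ : P → ℝ → H} {s : P → ℝ} (hs : ContDiff ℝ ∞ s)
    (hγ : ContMDiff 𝓘(ℝ, P × ℝ) 𝓘(ℝ, E) ∞ (Function.uncurry γ)) :
    ContDiff ℝ ∞ (F := E) (fun p => leftLogDeriv (E := E) (γ p) (s p)) := by
  have : IsManifold 𝓘(ℝ, E) 1 H := IsManifold.of_le (n := ∞) (by simp)
  have at_s : ContMDiff 𝓘(ℝ, P × ℝ) 𝓘(ℝ, E) ∞ (fun q : P × ℝ => γ q.1 (s q.1)) :=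
    hγ.comp (contDiff_fst.prodMk (hs.comp contDiff_fst)).contMDiff
  have after_s : ContMDiff 𝓘(ℝ, P × ℝ) 𝓘(ℝ, E) ∞ (fun q : P × ℝ => γ q.1 (s q.1 + q.2)) :=
    hγ.comp (contDiff_fst.prodMk ((hs.comp contDiff_fst).add contDiff_snd)).contMDiff
  have translated := at_s.inv.mul after_s
  rw [modelWithCornersSelf_prod, ← chartedSpaceSelf_prod] at translated
  have derivative_smooth := contDiff_mfderiv_of_forall_eq (x := (0 : ℝ)) (y := (1 : H))
    (f := fun p t => (γ p (s p))⁻¹ * γ p (s p + t)) translated fun p => by simp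
  refine (ContMDiff.congr (ContDiff.clm_apply (F := ℝ) (G := E) derivative_smooth
    (contDiff_const (c := (1 : ℝ)))).contMDiff fun p => ?_).contDiff
  exact leftLogDeriv_eq_mfderiv_translate
    ((hγ.comp (contDiff_prodMk_right p).contMDiff).mdifferentiable (by simp) _)

end LogarithmicDerivative

section Action

variable {EG : Type*} [NormedAddCommGroup EG] [NormedSpace ℝ EG]
  {G : Type*} [TopologicalSpace G] [ChartedSpace EG G] [Group G] [LieGroup 𝓘(ℝ, EG) ∞ G]
  {EH : Type*} [NormedAddCommGroup EH] [NormedSpace ℝ EH]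
  {H : Type*} [TopologicalSpace H] [ChartedSpace EH H] [Group H] [LieGroup 𝓘(ℝ, EH) ∞ H]
  (X : LieCrossedModule EG G EH H)

namespace LieCrossedModule

lemma contMDiff_action {P EP : Type*} [NormedAddCommGroup EP] [NormedSpace ℝ EP]
    [TopologicalSpace P] [ChartedSpace EP P] {a : P → G} {h : P → H}
    (ha : ContMDiff 𝓘(ℝ, EP) 𝓘(ℝ, EG) ∞ a) (hh : ContMDiff 𝓘(ℝ, EP) 𝓘(ℝ, EH) ∞ h) :
    ContMDiff 𝓘(ℝ, EP) 𝓘(ℝ, EH) ∞ (fun p => X.m (a p) (h p)) :=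
  X.contMDiff_m.comp (ha.prodMk hh)

lemma mdifferentiable_m (a : G) : MDifferentiable 𝓘(ℝ, EH) 𝓘(ℝ, EH) (fun h : H => X.m a h) :=
  (X.contMDiff_action contMDiff_const contMDiff_id).mdifferentiable (by simp)

lemma mDot_neg (a : G) (v : GroupLieAlgebra 𝓘(ℝ, EH) H) : X.mDot a (-v) = -X.mDot a v :=
  ContinuousLinearMap.map_neg (M := EH) (M₂ := EH)
    (mfderiv 𝓘(ℝ, EH) 𝓘(ℝ, EH) (fun h : H => X.m a h) (1 : H)) v

lemma mDot_leftLogDeriv (a : G) {γ : ℝ → H} {s : ℝ}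
    (hγ : MDifferentiableAt 𝓘(ℝ, ℝ) 𝓘(ℝ, EH) γ s) :
    X.mDot a (leftLogDeriv (E := EH) γ s) = leftLogDeriv (E := EH) (fun s => X.m a (γ s)) s :=
  (leftLogDeriv_map (φ := (X.m a).toMonoidHom) (X.mdifferentiable_m a) hγ).symm

lemma mDot_one (v : GroupLieAlgebra 𝓘(ℝ, EH) H) : X.mDot (1 : G) v = v := by
  have m_one : (fun h : H => X.m (1 : G) h) = id := funext fun h => by simp
  rw [mDot, m_one, mfderiv_id]
  rfl

lemma mDot_mul (a b : G) (v : GroupLieAlgebra 𝓘(ℝ, EH) H) :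
    X.mDot (a * b) v = X.mDot a (X.mDot b v) := by
  have m_mul : (fun h : H => X.m (a * b) h) = (fun h => X.m a h) ∘ fun h => X.m b h :=
    funext fun h => by simp
  rw [mDot, m_mul, mfderiv_comp_of_eq (X.mdifferentiable_m a 1) (X.mdifferentiable_m b 1)
    (map_one (X.m b))]
  exact congrArg (fun x => (mfderiv 𝓘(ℝ, EH) 𝓘(ℝ, EH) (fun h : H => X.m a h) x : EH →L[ℝ] EH)
    (X.mDot b v)) (map_one (X.m b))

lemma neg_mDot_neg_mDot (a b : G) (v : GroupLieAlgebra 𝓘(ℝ, EH) H) :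
    -X.mDot a (-X.mDot b v) = X.mDot (a * b) v :=
  (congrArg (fun w : EH => -w) (X.mDot_neg _ _)).trans
    ((neg_neg (_ : EH)).trans (X.mDot_mul a b v).symm)

lemma mDot_mDot_inv (a : G) (v : GroupLieAlgebra 𝓘(ℝ, EH) H) :
    X.mDot a (X.mDot a⁻¹ v) = v := by
  rw [← X.mDot_mul, mul_inv_cancel, X.mDot_one]

lemma contDiff_mDot {P : Type*} [NormedAddCommGroup P] [NormedSpace ℝ P] {a : P → G} {v : P → EH}
    (ha : ContMDiff 𝓘(ℝ, P) 𝓘(ℝ, EG) ∞ a) (hv : ContDiff ℝ ∞ v) :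
    ContDiff ℝ ∞ (F := EH) (fun p => X.mDot (a p) (v p)) := by
  have : IsManifold 𝓘(ℝ, EH) 1 H := IsManifold.of_le (n := ∞) (by simp)
  have action_smooth : ContMDiff (𝓘(ℝ, P).prod 𝓘(ℝ, EH)) 𝓘(ℝ, EH) ∞
      (Function.uncurry fun (p : P) (h : H) => X.m (a p) h) :=
    X.contMDiff_m.comp ((ha.comp contMDiff_fst).prodMk contMDiff_snd)
  exact ContDiff.clm_apply (F := EH) (G := EH)
    (contDiff_mfderiv_of_forall_eq action_smooth fun p => map_one (X.m (a p))) hv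

end LieCrossedModule

end Action

section ChartAtOne

variable {E : Type*} [NormedAddCommGroup E] [NormedSpace ℝ E]

/-- The solution is read off the flow of the autonomous field `(F, (1, 0))`, whose second component
moves with velocity `(1, 0)`. -/
lemma exists_contDiffAt_solution {P : Type*} [NormedAddCommGroup P] [NormedSpace ℝ P]
    [CompleteSpace E] [CompleteSpace P] {n : ℕ} (hn : n ≠ 0) {F : E × (ℝ × P) → E} {z₀ : E}
    {q₀ : ℝ × P} (hF : ContDiffAt ℝ n F (z₀, q₀)) :
    ∃ u : ℝ × P → E, ContDiffAt ℝ n u q₀ ∧ u q₀ = z₀ ∧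
      ∀ᶠ q in 𝓝 q₀, HasDerivAt (fun x => u (x, q.2)) (F (u q, q)) q.1 := by
  obtain ⟨φ, smooth, flow⟩ := exists_contDiffAt_localFlow hn
    (f := fun w => (F w, ((1 : ℝ), (0 : P)))) (hF.prodMk contDiffAt_const)
  obtain ⟨ε, hε, hball⟩ := Metric.eventually_nhds_iff_ball.1 flow
  rw [← ball_prod_same] at hball
  let start : ℝ × P → E × (ℝ × P) := fun q => (z₀, (q₀.1, q.2))
  have start_mem : ∀ᶠ q in 𝓝 q₀, start q ∈ ball (z₀, q₀) ε :=
    (Continuous.tendsto (by fun_prop : Continuous start) q₀).eventually_mem (ball_mem_nhds _ hε)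
  have time_mem : ∀ᶠ q : ℝ × P in 𝓝 q₀, q.1 - q₀.1 ∈ ball (0 : ℝ) ε :=
    (Continuous.tendsto (by fun_prop : Continuous fun q : ℝ × P => q.1 - q₀.1) q₀).eventually_mem
      (by simpa using ball_mem_nhds (0 : ℝ) hε)
  have snd_flow {q : ℝ × P} (hq : start q ∈ ball (z₀, q₀) ε) :
      EqOn (fun t => (φ (start q, t)).2) (fun t => (q₀.1 + t, q.2)) (ball 0 ε) := by
    have curve_deriv (t : ℝ) (ht : t ∈ ball 0 ε) :
        HasDerivAt (fun t => (φ (start q, t)).2) ((1 : ℝ), (0 : P)) t :=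
      (hball (start q, t) ⟨hq, ht⟩).2.snd
    have line_deriv (t : ℝ) : HasDerivAt (fun t => (q₀.1 + t, q.2)) ((1 : ℝ), (0 : P)) t :=
      ((hasDerivAt_id t).const_add _).prodMk (hasDerivAt_const t _)
    refine isOpen_ball.eqOn_of_deriv_eq (convex_ball _ _).isPreconnected
      (fun t ht => (curve_deriv t ht).differentiableAt.differentiableWithinAt)
      (fun t _ => (line_deriv t).differentiableAt.differentiableWithinAt)
      (fun t ht => (curve_deriv t ht).deriv.trans (line_deriv t).deriv.symm) (mem_ball_self hε) ?_
    simp only [(hball (start q, 0) ⟨hq, mem_ball_self hε⟩).1, start, add_zero]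
  refine ⟨fun q => (φ (start q, q.1 - q₀.1)).1, ?_, ?_, ?_⟩
  · have : ContDiffAt ℝ n (fun q : ℝ × P => (start q, q.1 - q₀.1)) q₀ := by fun_prop
    have start_eq : (start q₀, q₀.1 - q₀.1) = ((z₀, q₀), (0 : ℝ)) := by simp only [start, sub_self]
    exact contDiffAt_fst.comp q₀ (ContDiffAt.comp q₀ (start_eq ▸ smooth) this)
  · have := (hball (start q₀, 0) ⟨start_mem.self_of_nhds, mem_ball_self hε⟩).1
    simp only [sub_self, this, start]
  · filter_upwards [start_mem, time_mem] with q hq ht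
    have at_q : (φ (start q, q.1 - q₀.1)).2 = q := by simp [snd_flow hq ht]
    have curve_deriv : HasDerivAt (fun t => (φ (start q, t)).1) (F (φ (start q, q.1 - q₀.1)))
        (q.1 - q₀.1) := (hball (start q, q.1 - q₀.1) ⟨hq, ht⟩).2.fst
    rw [← Prod.mk.eta (p := φ (start q, q.1 - q₀.1)), at_q] at curve_deriv
    exact curve_deriv.comp_sub_const q.1 q₀.1

variable {H : Type*} [TopologicalSpace H] [ChartedSpace E H] [Group H]

/-- The preferred chart at the identity, as a map to the model space. -/
abbrev oneChart (E H : Type*) [NormedAddCommGroup E] [NormedSpace ℝ E]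
    [TopologicalSpace H] [ChartedSpace E H] [Group H] : PartialEquiv H E :=
  extChartAt 𝓘(ℝ, E) (1 : H)

/-- The product of the Lie group `H`, read in the chart at the identity. -/
def chartMul (H : Type*) [TopologicalSpace H] [ChartedSpace E H] [Group H] (u z : E) : E :=
  oneChart E H ((oneChart E H).symm u * (oneChart E H).symm z)

/-- The tangent space at `1` is identified with `E` by this very chart. -/
lemma hasMFDerivAt_oneChart_symm :
    HasMFDerivAt 𝓘(ℝ, E) 𝓘(ℝ, E) (oneChart E H).symm (oneChart E H 1)
      (ContinuousLinearMap.id ℝ E) := by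
  refine ⟨continuousAt_extChartAt_symm (1 : H), ?_⟩
  refine ((hasFDerivAt_id (oneChart E H 1)).congr_of_eventuallyEq ?_).hasFDerivWithinAt
  filter_upwards [extChartAt_target_mem_nhds (I := 𝓘(ℝ, E)) (1 : H)] with z hz
  simp only [writtenInExtChartAt, Function.comp_apply, extChartAt_to_inv, id]
  exact (oneChart E H).right_inv hz

variable [LieGroup 𝓘(ℝ, E) ∞ H]

lemma contMDiffAt_oneChart_symm {z : E} (hz : z ∈ (oneChart E H).target) :
    ContMDiffAt 𝓘(ℝ, E) 𝓘(ℝ, E) ∞ (oneChart E H).symm z :=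
  (contMDiffOn_extChartAt_symm (n := ∞) (1 : H)).contMDiffAt
    ((isOpen_extChartAt_target (1 : H)).mem_nhds hz)

lemma eventually_mul_mem_oneChart_source {u : E} (hu : u ∈ (oneChart E H).target) :
    ∀ᶠ z in 𝓝 (oneChart E H 1),
      (oneChart E H).symm u * (oneChart E H).symm z ∈ (oneChart E H).source := by
  have product_continuous : ContinuousAt
      (fun z => (oneChart E H).symm u * (oneChart E H).symm z) (oneChart E H 1) :=
    (mdifferentiable_mul_left (E := E) _).continuous.continuousAt.comp
      (continuousAt_extChartAt_symm (1 : H))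
  refine product_continuous.eventually_mem ((isOpen_extChartAt_source (1 : H)).mem_nhds ?_)
  rw [extChartAt_to_inv, mul_one]
  exact (oneChart E H).map_target hu

lemma contDiffAt_chartMul {u : E} (hu : u ∈ (oneChart E H).target) :
    ContDiffAt ℝ ∞ (Function.uncurry (chartMul (E := E) H)) (u, oneChart E H 1) := by
  have fst_smooth : ContMDiffAt 𝓘(ℝ, E × E) 𝓘(ℝ, E) ∞ (fun p : E × E => (oneChart E H).symm p.1)
      (u, oneChart E H 1) := ContMDiffAt.comp (u, oneChart E H 1) (g := (oneChart E H).symm)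
    (contMDiffAt_oneChart_symm hu) contDiff_fst.contMDiff.contMDiffAt
  have snd_smooth : ContMDiffAt 𝓘(ℝ, E × E) 𝓘(ℝ, E) ∞ (fun p : E × E => (oneChart E H).symm p.2)
      (u, oneChart E H 1) := ContMDiffAt.comp (u, oneChart E H 1) (g := (oneChart E H).symm)
    (contMDiffAt_oneChart_symm (mem_extChartAt_target 1)) contDiff_snd.contMDiff.contMDiffAt
  have chart_smooth : ContMDiffAt 𝓘(ℝ, E) 𝓘(ℝ, E) ∞ (oneChart E H)
      ((oneChart E H).symm u * (oneChart E H).symm (oneChart E H 1)) := by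
    refine contMDiffAt_extChartAt' ?_
    rw [← extChartAt_source 𝓘(ℝ, E)]
    exact (eventually_mul_mem_oneChart_source hu).self_of_nhds
  exact (chart_smooth.comp (u, oneChart E H 1) (fst_smooth.mul snd_smooth)).contDiffAt

lemma leftLogDeriv_oneChart_symm {u : ℝ → E} {s : ℝ} {v : E}
    (hu : u s ∈ (oneChart E H).target)
    (hd : HasDerivAt u (fderiv ℝ (chartMul H (u s)) (oneChart E H 1) v) s) :
    leftLogDeriv (E := E) (fun s => (oneChart E H).symm (u s)) s = v := by
  let e : E := oneChart E H 1
  let C : E → H := fun w => ((oneChart E H).symm (u s))⁻¹ * (oneChart E H).symm w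
  have symm_diff := (contMDiffAt_oneChart_symm hu).mdifferentiableAt (n := ∞) (by simp)
  have C_diff : MDifferentiableAt 𝓘(ℝ, E) 𝓘(ℝ, E) C (u s) :=
    (mdifferentiable_mul_left _ _).comp (u s) symm_diff
  have chartMul_deriv : HasFDerivAt (chartMul H (u s)) (fderiv ℝ (chartMul H (u s)) e) e :=
    (((contDiffAt_chartMul hu).comp e (contDiffAt_const.prodMk contDiffAt_id)).differentiableAt
      (by simp)).hasFDerivAt
  have chartMul_e : chartMul H (u s) e = u s := by
    rw [chartMul, extChartAt_to_inv, mul_one, (oneChart E H).right_inv hu]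
  obtain ⟨A, C_deriv⟩ : ∃ A : E →L[ℝ] E, ∀ w, w = u s → HasMFDerivAt 𝓘(ℝ, E) 𝓘(ℝ, E) C w A :=
    ⟨mfderiv 𝓘(ℝ, E) 𝓘(ℝ, E) C (u s), by rintro _ rfl; exact C_diff.hasMFDerivAt⟩
  have C_chartMul : (oneChart E H).symm =ᶠ[𝓝 e] C ∘ chartMul H (u s) := by
    filter_upwards [eventually_mul_mem_oneChart_source hu] with z hz
    simp only [C, Function.comp_apply, chartMul, (oneChart E H).left_inv hz, inv_mul_cancel_left]
  have inverse : A.comp (fderiv ℝ (chartMul H (u s)) e) = ContinuousLinearMap.id ℝ E :=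
    hasMFDerivAt_unique (((C_deriv _ chartMul_e).comp e chartMul_deriv.hasMFDerivAt
      ).congr_of_eventuallyEq C_chartMul) hasMFDerivAt_oneChart_symm
  have u_deriv := hd.hasFDerivAt.hasMFDerivAt
  refine leftLogDeriv_eq_of_hasMFDerivAt (symm_diff.comp s u_deriv.mdifferentiableAt) ?_
  refine ((C_deriv _ rfl).comp s u_deriv).congr_mfderiv ?_
  exact (A.comp_toSpanSingleton _).trans
    (congrArg _ (DFunLike.congr_fun inverse v))

end ChartAtOne

section LogSolutions

variable {E : Type*} [NormedAddCommGroup E] [NormedSpace ℝ E]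
  {H : Type*} [TopologicalSpace H] [ChartedSpace E H] [Group H]
  {P : Type*} [NormedAddCommGroup P] [NormedSpace ℝ P]

/-- `M` is `n` times continuously differentiable on the product of an open interval `I` and an open
set `V` of parameters, and `x ↦ M (x, y)` has left logarithmic derivative `ξ (x, y)` there. -/
structure IsLogSolutionOn (n : ℕ) (ξ : ℝ × P → E) (M : ℝ × P → H) (I : Set ℝ) (V : Set P) :
    Prop where
  isOpen_interval : IsOpen I
  ordConnected : I.OrdConnected
  isOpen_params : IsOpen V
  contMDiffOn : ContMDiffOn 𝓘(ℝ, ℝ × P) 𝓘(ℝ, E) n M (I ×ˢ V)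
  leftLogDeriv_eq : ∀ x ∈ I, ∀ y ∈ V, leftLogDeriv (E := E) (fun x' => M (x', y)) x = ξ (x, y)

namespace IsLogSolutionOn

variable {n n' : ℕ} {ξ : ℝ × P → E} {M N : ℝ × P → H} {I J : Set ℝ} {V W : Set P}

lemma contMDiffAt (h : IsLogSolutionOn n ξ M I V) {q : ℝ × P} (hq : q ∈ I ×ˢ V) :
    ContMDiffAt 𝓘(ℝ, ℝ × P) 𝓘(ℝ, E) n M q :=
  h.contMDiffOn.contMDiffAt ((h.isOpen_interval.prod h.isOpen_params).mem_nhds hq)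

lemma contMDiffOn_slice (h : IsLogSolutionOn n ξ M I V) {x : ℝ} (hx : x ∈ I) :
    ContMDiffOn 𝓘(ℝ, P) 𝓘(ℝ, E) n (fun y => M (x, y)) V :=
  h.contMDiffOn.comp (contDiff_const.prodMk contDiff_id).contMDiff.contMDiffOn fun _ hy => ⟨hx, hy⟩

lemma mono_params (h : IsLogSolutionOn n ξ M I V) (hW : IsOpen W) (hWV : W ⊆ V) :
    IsLogSolutionOn n ξ M I W where
  isOpen_interval := h.isOpen_interval
  ordConnected := h.ordConnected
  isOpen_params := hW
  contMDiffOn := h.contMDiffOn.mono (prod_mono_right hWV)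
  leftLogDeriv_eq x hx y hy := h.leftLogDeriv_eq x hx y (hWV hy)

lemma congr (h : IsLogSolutionOn n ξ M I V) (hNM : EqOn N M (I ×ˢ V)) :
    IsLogSolutionOn n ξ N I V where
  isOpen_interval := h.isOpen_interval
  ordConnected := h.ordConnected
  isOpen_params := h.isOpen_params
  contMDiffOn := h.contMDiffOn.congr hNM
  leftLogDeriv_eq x hx y hy := by
    rw [← h.leftLogDeriv_eq x hx y hy]
    refine leftLogDeriv_congr ?_
    filter_upwards [h.isOpen_interval.mem_nhds hx] with x' hx' using hNM ⟨hx', hy⟩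

lemma union (h : IsLogSolutionOn n ξ M I V) (h' : IsLogSolutionOn n ξ M J V)
    (hIJ : (I ∩ J).Nonempty) : IsLogSolutionOn n ξ M (I ∪ J) V where
  isOpen_interval := h.isOpen_interval.union h'.isOpen_interval
  ordConnected := (h.ordConnected.isPreconnected.union' hIJ
    h'.ordConnected.isPreconnected).ordConnected
  isOpen_params := h.isOpen_params
  contMDiffOn := by
    rw [union_prod]
    exact h.contMDiffOn.union_of_isOpen h'.contMDiffOn
      (h.isOpen_interval.prod h.isOpen_params) (h'.isOpen_interval.prod h.isOpen_params)
  leftLogDeriv_eq x hx y hy :=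
    hx.elim (fun hx => h.leftLogDeriv_eq x hx y hy) (fun hx => h'.leftLogDeriv_eq x hx y hy)

lemma mdifferentiableAt (hn : n ≠ 0) (h : IsLogSolutionOn n ξ M I V) {x : ℝ} {y : P} (hx : x ∈ I)
    (hy : y ∈ V) : MDifferentiableAt 𝓘(ℝ, ℝ) 𝓘(ℝ, E) (fun x' => M (x', y)) x :=
  ((h.contMDiffAt (mk_mem_prod hx hy)).mdifferentiableAt (by exact_mod_cast hn)).comp x
    (differentiableAt_id.prodMk (differentiableAt_const y)).mdifferentiableAt

variable [LieGroup 𝓘(ℝ, E) ∞ H]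

lemma mul_left (hn : n ≠ 0) (h : IsLogSolutionOn n ξ M I V) {a : P → H}
    (ha : ContMDiffOn 𝓘(ℝ, P) 𝓘(ℝ, E) n a V) :
    IsLogSolutionOn n ξ (fun q => a q.2 * M q) I V where
  isOpen_interval := h.isOpen_interval
  ordConnected := h.ordConnected
  isOpen_params := h.isOpen_params
  contMDiffOn := by
    have : LieGroup 𝓘(ℝ, E) n H := LieGroup.of_le (n := ∞) (by exact_mod_cast le_top)
    exact (ha.comp contDiff_snd.contMDiff.contMDiffOn fun q hq => hq.2).mul h.contMDiffOn
  leftLogDeriv_eq x hx y hy :=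
    (leftLogDeriv_mul_left (a y) (h.mdifferentiableAt hn hx hy)).trans (h.leftLogDeriv_eq x hx y hy)

lemma eq_mul (hn : n ≠ 0) (hn' : n' ≠ 0) (h : IsLogSolutionOn n ξ M I V)
    (h' : IsLogSolutionOn n' ξ N J W) {x₀ x : ℝ} {y : P} (hx₀ : x₀ ∈ I ∩ J) (hx : x ∈ I ∩ J)
    (hy : y ∈ V ∩ W) : M (x, y) = M (x₀, y) / N (x₀, y) * N (x, y) :=
  eqOn_mul_of_leftLogDeriv_eq (E := E) (γ := fun x => M (x, y)) (γ' := fun x => N (x, y))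
    (h.isOpen_interval.inter h'.isOpen_interval)
    (h.ordConnected.inter h'.ordConnected).isPreconnected
    (fun _ hs => h.mdifferentiableAt hn hs.1 hy.1)
    (fun _ hs => h'.mdifferentiableAt hn' hs.2 hy.2)
    (fun _ hs => (h.leftLogDeriv_eq _ hs.1 _ hy.1).trans (h'.leftLogDeriv_eq _ hs.2 _ hy.2).symm)
    hx₀ hx

lemma exists_glue (hn : n ≠ 0) (h : IsLogSolutionOn n ξ M I V) (h' : IsLogSolutionOn n ξ N J W)
    (hIJ : (I ∩ J).Nonempty) : ∃ L : ℝ × P → H, IsLogSolutionOn n ξ L (I ∪ J) (V ∩ W) := by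
  classical
  have : LieGroup 𝓘(ℝ, E) n H := LieGroup.of_le (n := ∞) (by exact_mod_cast le_top)
  obtain ⟨p, hp⟩ := id hIJ
  have hVW : IsOpen (V ∩ W) := h.isOpen_params.inter h'.isOpen_params
  replace h := h.mono_params hVW inter_subset_left
  replace h' := h'.mono_params hVW inter_subset_right
  have translated : IsLogSolutionOn n ξ (fun q => M (p, q.2) / N (p, q.2) * N q) J (V ∩ W) :=
    h'.mul_left hn ((h.contMDiffOn_slice hp.1).div (h'.contMDiffOn_slice hp.2))
  refine ⟨fun q => if q.1 ∈ I then M q else M (p, q.2) / N (p, q.2) * N q,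
    (h.congr fun q hq => if_pos hq.1).union (translated.congr fun q hq => ?_) hIJ⟩
  by_cases hqI : q.1 ∈ I
  · exact (if_pos hqI).trans (h.eq_mul hn hn h' hp ⟨hqI, hq.1⟩ ⟨hq.2, hq.2⟩)
  · exact if_neg hqI

lemma exists_normalized (hn : n ≠ 0) (h : IsLogSolutionOn n ξ M I V) {s₀ : ℝ} (hs₀ : s₀ ∈ I) :
    ∃ N : ℝ × P → H, IsLogSolutionOn n ξ N I V ∧ ∀ y, N (s₀, y) = 1 := by
  have : LieGroup 𝓘(ℝ, E) n H := LieGroup.of_le (n := ∞) (by exact_mod_cast le_top)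
  exact ⟨fun q => (M (s₀, q.2))⁻¹ * M q, h.mul_left hn (h.contMDiffOn_slice hs₀).inv,
    fun y => inv_mul_cancel _⟩

lemma eq_of_normalized (hn : n ≠ 0) (hn' : n' ≠ 0) (h : IsLogSolutionOn n ξ M I V)
    (h' : IsLogSolutionOn n' ξ N J W) {s₀ x : ℝ} {y : P} (hs₀ : s₀ ∈ I ∩ J)
    (hM : ∀ y, M (s₀, y) = 1) (hN : ∀ y, N (s₀, y) = 1) (hx : x ∈ I ∩ J) (hy : y ∈ V ∩ W) :
    M (x, y) = N (x, y) := by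
  simpa only [hM, hN, div_one, one_mul] using h.eq_mul hn hn' h' hs₀ hx hy

end IsLogSolutionOn

variable [LieGroup 𝓘(ℝ, E) ∞ H] [CompleteSpace E] [CompleteSpace P] {ξ : ℝ × P → E}

/-- In the chart at the identity, the solutions are the integral curves of the left invariant
vector field with value `ξ` at `1`. -/
lemma exists_isLogSolutionOn_nhds (hξ : ContDiff ℝ ∞ ξ) {n : ℕ} (hn : n ≠ 0) (q₀ : ℝ × P) :
    ∃ (M : ℝ × P → H) (I : Set ℝ) (V : Set P), IsLogSolutionOn n ξ M I V ∧ q₀ ∈ I ×ˢ V := by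
  let e : E := oneChart E H 1
  have field_smooth : ContDiffAt ℝ ∞
      (fun w : E × (ℝ × P) => fderiv ℝ (chartMul H w.1) e (ξ w.2)) (e, q₀) := by
    refine ContDiffAt.clm_apply (ContDiffAt.fderiv (n := ∞)
      (f := fun w : E × (ℝ × P) => chartMul H w.1) ?_ contDiffAt_const (by simp))
      (hξ.contDiffAt.comp _ contDiffAt_snd)
    exact ContDiffAt.comp ((e, q₀), e) (g := Function.uncurry (chartMul H))
      (f := fun p : (E × (ℝ × P)) × E => (p.1.1, p.2))
      (contDiffAt_chartMul (mem_extChartAt_target 1)) (by fun_prop)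
  obtain ⟨u, u_smooth, initial, u_deriv⟩ := exists_contDiffAt_solution hn
    (field_smooth.of_le (by exact_mod_cast le_top : (n : ℕ∞ω) ≤ ∞))
  have mem_target : ∀ᶠ q in 𝓝 q₀, u q ∈ (oneChart E H).target :=
    u_smooth.continuousAt.eventually_mem (initial ▸ extChartAt_target_mem_nhds (1 : H))
  obtain ⟨ε, hε, hball⟩ := Metric.eventually_nhds_iff_ball.1
    ((u_smooth.eventually (by simp)).and (mem_target.and u_deriv))
  rw [← Prod.mk.eta (p := q₀), ← ball_prod_same] at hball
  refine ⟨fun q => (oneChart E H).symm (u q), ball q₀.1 ε, ball q₀.2 ε,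
    ⟨isOpen_ball, (convex_ball _ _).ordConnected, isOpen_ball, fun q hq => ?_, fun x hx y hy => ?_⟩,
    mem_ball_self hε, mem_ball_self hε⟩
  · obtain ⟨u_smooth, mem_target, -⟩ := hball q hq
    exact (((contMDiffAt_oneChart_symm mem_target).of_le (by exact_mod_cast le_top)).comp q
      u_smooth.contMDiffAt).contMDiffWithinAt
  · obtain ⟨-, mem_target, u_deriv⟩ := hball (x, y) ⟨hx, hy⟩
    exact leftLogDeriv_oneChart_symm (u := fun x => u (x, y)) mem_target u_deriv

lemma exists_isLogSolutionOn_of_mem_interval (hξ : ContDiff ℝ ∞ ξ) {n : ℕ} (hn : n ≠ 0)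
    (a b : ℝ) (y₀ : P) : ∃ (M : ℝ × P → H) (I : Set ℝ) (V : Set P),
      IsLogSolutionOn n ξ M I V ∧ a ∈ I ∧ b ∈ I ∧ y₀ ∈ V := by
  refine isPreconnected_univ.induction₂ (fun a b => ∃ (M : ℝ × P → H) (I : Set ℝ) (V : Set P),
      IsLogSolutionOn n ξ M I V ∧ a ∈ I ∧ b ∈ I ∧ y₀ ∈ V) ?near ?trans ?symm
    (mem_univ a) (mem_univ b)
  case near =>
    intro a _
    obtain ⟨M, I, V, h, ha, hy₀⟩ := exists_isLogSolutionOn_nhds (H := H) hξ hn (a, y₀)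
    exact nhdsWithin_le_nhds (mem_of_superset (h.isOpen_interval.mem_nhds ha)
      fun b hb => ⟨M, I, V, h, ha, hb, hy₀⟩)
  case trans =>
    rintro a b c - - - ⟨M, I, V, h, ha, hb, hy₀⟩ ⟨N, J, W, h', hb', hc, hy₀'⟩
    obtain ⟨L, hL⟩ := h.exists_glue hn h' ⟨b, hb, hb'⟩
    exact ⟨L, I ∪ J, V ∩ W, hL, .inl ha, .inr hc, hy₀, hy₀'⟩
  case symm =>
    rintro a b - - ⟨M, I, V, h, ha, hb, hy₀⟩
    exact ⟨M, I, V, h, hb, ha, hy₀⟩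

/-- The domain in the parameter on which a solution is found depends on `x` and on the order of
differentiability, but by uniqueness all normalised solutions are pieces of one map. -/
theorem exists_contMDiff_solvesLeftLog (hξ : ContDiff ℝ ∞ ξ) (s₀ : ℝ) :
    ∃ L : ℝ × P → H, ContMDiff 𝓘(ℝ, ℝ × P) 𝓘(ℝ, E) ∞ L ∧
      ∀ y, SolvesLeftLog (E := E) (fun x => ξ (x, y)) s₀ (fun x => L (x, y)) := by
  have local_solution (n : ℕ) (q : ℝ × P) : ∃ (M : ℝ × P → H) (I : Set ℝ) (V : Set P),
      IsLogSolutionOn (n + 1) ξ M I V ∧ (∀ y, M (s₀, y) = 1) ∧ s₀ ∈ I ∧ q ∈ I ×ˢ V := by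
    obtain ⟨M, I, V, h, hs₀, hx, hy⟩ :=
      exists_isLogSolutionOn_of_mem_interval (H := H) hξ n.succ_ne_zero s₀ q.1 q.2
    obtain ⟨N, hN, normalized⟩ := h.exists_normalized n.succ_ne_zero hs₀
    exact ⟨N, I, V, hN, normalized, hs₀, hx, hy⟩
  choose M I V solution normalized hs₀ mem using local_solution
  let L : ℝ × P → H := fun q => M 0 q q
  have L_solution (n : ℕ) (q : ℝ × P) : IsLogSolutionOn (n + 1) ξ L (I n q) (V n q) := by
    refine (solution n q).congr fun q' hq' => ?_
    exact (solution 0 q').eq_of_normalized one_ne_zero n.succ_ne_zero (solution n q)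
      ⟨hs₀ 0 q', hs₀ n q⟩ (normalized 0 q') (normalized n q) ⟨(mem 0 q').1, hq'.1⟩
      ⟨(mem 0 q').2, hq'.2⟩
  refine ⟨L, contMDiff_infty.2 fun n q => ?_, fun y => ⟨fun x => ?_, fun x => ?_, ?_⟩⟩
  · exact ((L_solution n q).contMDiffAt (mem n q)).of_le (by exact_mod_cast n.le_succ)
  · exact (L_solution 0 (x, y)).mdifferentiableAt one_ne_zero (mem 0 (x, y)).1 (mem 0 (x, y)).2
  · exact (L_solution 0 (x, y)).leftLogDeriv_eq x (mem 0 (x, y)).1 y (mem 0 (x, y)).2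
  · exact normalized 0 (s₀, y) y

end LogSolutions

section Transport

variable {EG : Type*} [NormedAddCommGroup EG] [NormedSpace ℝ EG]
  {G : Type*} [TopologicalSpace G] [ChartedSpace EG G] [Group G]
  {EH : Type*} [NormedAddCommGroup EH] [NormedSpace ℝ EH]
  {H : Type*} [TopologicalSpace H] [ChartedSpace EH H] [Group H]
  {P : Type*} [NormedAddCommGroup P] [NormedSpace ℝ P]

/-- A smooth family of two-point functions `f(x', x; y)` that is multiplicative along the line.
It stands for the parallel transports of a connection, with parameter `y`. -/
structure IsTransport (f : ℝ → ℝ → P → G) : Prop where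
  contMDiff : ContMDiff 𝓘(ℝ, ℝ × ℝ × P) 𝓘(ℝ, EG) ∞ (fun p : ℝ × ℝ × P => f p.1 p.2.1 p.2.2)
  comp : ∀ (x'' x' x : ℝ) (y : P), f x'' x y = f x'' x' y * f x' x y

namespace IsTransport

variable {f : ℝ → ℝ → P → G}

lemma self (hf : IsTransport (EG := EG) f) (x : ℝ) (y : P) : f x x y = 1 :=
  left_eq_mul.1 (hf.comp x x x y)

lemma inv (hf : IsTransport (EG := EG) f) (x' x : ℝ) (y : P) : (f x' x y)⁻¹ = f x x' y :=
  inv_eq_of_mul_eq_one_left (by rw [← hf.comp, hf.self])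

end IsTransport

/-- The infinitesimal generator of a two-point function `Ψ(x', x; y)`: its left logarithmic
derivative in `x'` on the diagonal `x' = x`. -/
def generator (EH : Type*) [NormedAddCommGroup EH] [NormedSpace ℝ EH]
    {H : Type*} [TopologicalSpace H] [ChartedSpace EH H] [Group H] {P : Type*}
    (Ψ : ℝ → ℝ → P → H) (x : ℝ) (y : P) : GroupLieAlgebra 𝓘(ℝ, EH) H :=
  leftLogDeriv (E := EH) (fun x' => Ψ x' x y) x

variable [LieGroup 𝓘(ℝ, EH) ∞ H]

lemma contDiff_generator {Ψ : ℝ → ℝ → P → H}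
    (hΨ : ContMDiff 𝓘(ℝ, ℝ × ℝ × P) 𝓘(ℝ, EH) ∞ (fun p : ℝ × ℝ × P => Ψ p.1 p.2.1 p.2.2)) :
    ContDiff ℝ ∞ (F := EH) (fun p : ℝ × P => generator EH Ψ p.1 p.2) := by
  have permute : ContDiff ℝ ∞ (fun q : (ℝ × P) × ℝ => (q.2, q.1.1, q.1.2)) := by fun_prop
  exact contDiff_leftLogDeriv (γ := fun (p : ℝ × P) x' => Ψ x' p.1 p.2) contDiff_fst
    (hΨ.comp permute.contMDiff)

variable [LieGroup 𝓘(ℝ, EG) ∞ G]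

/-- A smooth family of two-point functions `Ψ(x', x; y)` that is crossed multiplicative with
respect to `f`. Both components `Ψ` and `Φ` of a 1-gauge transformation are of this kind. -/
structure IsCrossedTransport (X : LieCrossedModule EG G EH H) (f : ℝ → ℝ → P → G)
    (Ψ : ℝ → ℝ → P → H) : Prop where
  contMDiff : ContMDiff 𝓘(ℝ, ℝ × ℝ × P) 𝓘(ℝ, EH) ∞ (fun p : ℝ × ℝ × P => Ψ p.1 p.2.1 p.2.2)
  comp : ∀ (x'' x' x : ℝ) (y : P), Ψ x'' x y = Ψ x' x y * X.m (f x' x y)⁻¹ (Ψ x'' x' y)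

variable {X : LieCrossedModule EG G EH H} {f : ℝ → ℝ → P → G}

namespace IsCrossedTransport

variable {Ψ : ℝ → ℝ → P → H}

lemma self (hf : IsTransport (EG := EG) f) (hΨ : IsCrossedTransport X f Ψ) (x : ℝ) (y : P) :
    Ψ x x y = 1 := by
  have square := hΨ.comp x x x y
  rw [hf.self, inv_one, map_one, MulAut.one_apply] at square
  exact left_eq_mul.1 square

lemma mdifferentiable (hΨ : IsCrossedTransport X f Ψ) (x : ℝ) (y : P) :
    MDifferentiable 𝓘(ℝ, ℝ) 𝓘(ℝ, EH) (fun x' => Ψ x' x y) :=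
  (hΨ.contMDiff.comp (contDiff_prodMk_left (x, y)).contMDiff).mdifferentiable (by simp)

/-- Differentiating `Ψ(x', x₀; y) = Ψ(x, x₀; y) m(f(x, x₀; y)⁻¹)(Ψ(x', x; y))` at `x' = x` yields
the differential equation. -/
lemma solvesLeftLog (hf : IsTransport (EG := EG) f) (hΨ : IsCrossedTransport X f Ψ)
    (x₀ : ℝ) (y : P) :
    SolvesLeftLog (E := EH) (fun x => X.mDot (f x x₀ y)⁻¹ (generator EH Ψ x y)) x₀
      (fun x => Ψ x x₀ y) := by
  refine ⟨hΨ.mdifferentiable x₀ y, fun x => ?_, hΨ.self hf x₀ y⟩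
  have curve_eq : (fun x' => Ψ x' x₀ y) = fun x' => Ψ x x₀ y * X.m (f x x₀ y)⁻¹ (Ψ x' x y) :=
    funext fun x' => hΨ.comp x' x x₀ y
  rw [curve_eq]
  exact (leftLogDeriv_mul_left _
    ((X.mdifferentiable_m _ _).comp x (hΨ.mdifferentiable x y x))).trans
    (X.mDot_leftLogDeriv _ (hΨ.mdifferentiable x y x)).symm

end IsCrossedTransport

/-- The crossed transport with respect to `f` obtained from a family of curves `L`; every crossed
transport `Ψ` is of this form, with `L(x, y) = Ψ(x, 0; y)`. -/
def crossedTransport {P : Type*} (X : LieCrossedModule EG G EH H) (f : ℝ → ℝ → P → G)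
    (L : ℝ × P → H) (x' x : ℝ) (y : P) : H :=
  X.m (f x 0 y) ((L (x, y))⁻¹ * L (x', y))

lemma isCrossedTransport_crossedTransport (hf : IsTransport (EG := EG) f) {L : ℝ × P → H}
    (hL : ContMDiff 𝓘(ℝ, ℝ × P) 𝓘(ℝ, EH) ∞ L) :
    IsCrossedTransport X f (crossedTransport X f L) where
  contMDiff := by
    have base : ContDiff ℝ ∞ (fun p : ℝ × ℝ × P => (p.2.1, (0 : ℝ), p.2.2)) := by fun_prop
    have initial : ContDiff ℝ ∞ (fun p : ℝ × ℝ × P => (p.2.1, p.2.2)) := by fun_prop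
    have final : ContDiff ℝ ∞ (fun p : ℝ × ℝ × P => (p.1, p.2.2)) := by fun_prop
    exact X.contMDiff_action (hf.contMDiff.comp base.contMDiff)
      ((hL.comp initial.contMDiff).inv.mul (hL.comp final.contMDiff))
  comp x'' x' x y := by
    unfold crossedTransport
    rw [hf.inv, ← MulAut.mul_apply, ← map_mul, ← hf.comp, ← map_mul]
    group

lemma generator_crossedTransport {P : Type*} {f : ℝ → ℝ → P → G} {L : ℝ × P → H} {x : ℝ} {y : P}
    (hL : MDifferentiable 𝓘(ℝ, ℝ) 𝓘(ℝ, EH) fun x' => L (x', y)) :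
    generator EH (crossedTransport X f L) x y =
      X.mDot (f x 0 y) (leftLogDeriv (E := EH) (fun x' => L (x', y)) x) := by
  refine (X.mDot_leftLogDeriv (f x 0 y) (γ := fun x' => (L (x, y))⁻¹ * L (x', y))
    ((mdifferentiable_mul_left _ _).comp x (hL x))).symm.trans ?_
  exact congrArg (X.mDot (f x 0 y)) (leftLogDeriv_mul_left (E := EH) _ (hL x))

lemma exists_isCrossedTransport_generator_eq [CompleteSpace EH] [CompleteSpace P]
    (X : LieCrossedModule EG G EH H) (hf : IsTransport (EG := EG) f) {η : ℝ × P → EH}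
    (hη : ContDiff ℝ ∞ η) :
    ∃ Ψ : ℝ → ℝ → P → H, IsCrossedTransport X f Ψ ∧ ∀ x y, generator EH Ψ x y = η (x, y) := by
  have base : ContDiff ℝ ∞ (fun p : ℝ × P => (p.1, (0 : ℝ), p.2)) := by fun_prop
  obtain ⟨L, L_smooth, L_solves⟩ := exists_contMDiff_solvesLeftLog (H := H)
    (X.contDiff_mDot (hf.contMDiff.comp base.contMDiff).inv hη) 0
  refine ⟨crossedTransport X f L, isCrossedTransport_crossedTransport hf L_smooth, fun x y => ?_⟩
  obtain ⟨L_diff, L_deriv, -⟩ := L_solves y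
  exact (generator_crossedTransport L_diff).trans
    ((congrArg (X.mDot (f x 0 y)) (L_deriv x)).trans (X.mDot_mDot_inv _ _))

end Transport

section Correspondence

variable {EG : Type*} [NormedAddCommGroup EG] [NormedSpace ℝ EG]
  {G : Type*} [TopologicalSpace G] [ChartedSpace EG G]
  {EH : Type*} [NormedAddCommGroup EH] [NormedSpace ℝ EH]
  {H : Type*} [TopologicalSpace H] [ChartedSpace EH H] [Group H]

attribute [ext] IntegralGauge DifferentialGauge

section OneForm

variable {F : Type*} [NormedAddCommGroup F] [NormedSpace ℝ F]

/-- The covector `a dx + b dy` with coefficients in `F`; the values of the 1-form of a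
differential gauge transformation are built from it. -/
def oneForm (a b : F) : ℝ × ℝ →L[ℝ] F :=
  (ContinuousLinearMap.fst ℝ ℝ ℝ).smulRight a + (ContinuousLinearMap.snd ℝ ℝ ℝ).smulRight b

lemma oneForm_dx (a b : F) : oneForm a b (1, 0) = a := by simp [oneForm]

lemma oneForm_dy (a b : F) : oneForm a b (0, 1) = b := by simp [oneForm]

lemma eq_oneForm (α : ℝ × ℝ →L[ℝ] F) : α = oneForm (α (1, 0)) (α (0, 1)) := by
  ext <;> simp [oneForm]

lemma contDiff_oneForm {P : Type*} [NormedAddCommGroup P] [NormedSpace ℝ P] {a b : P → F}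
    (ha : ContDiff ℝ ∞ a) (hb : ContDiff ℝ ∞ b) : ContDiff ℝ ∞ (fun p => oneForm (a p) (b p)) :=
  (contDiff_const.smulRight ha).add (contDiff_const.smulRight hb)

end OneForm

namespace DifferentialGauge

lemma ext_components {D D' : DifferentialGauge EG G EH H} (hϰ : D.ϰ = D'.ϰ)
    (hx : ∀ x y, D.Γx x y = D'.Γx x y) (hy : ∀ x y, D.Γy x y = D'.Γy x y) : D = D' := by
  refine DifferentialGauge.ext hϰ (funext fun p => (eq_oneForm (F := EH) (D.Γ p)).trans ?_)
  exact (congrArg₂ (oneForm (F := EH)) (hx p.1 p.2) (hy p.1 p.2)).trans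
    (eq_oneForm (F := EH) (D'.Γ p)).symm

lemma contDiff_Γx (D : DifferentialGauge EG G EH H) :
    ContDiff ℝ ∞ (F := EH) (fun p : ℝ × ℝ => D.Γx p.1 p.2) :=
  ContDiff.clm_apply (F := ℝ × ℝ) (G := EH) D.contDiff_Γ contDiff_const

lemma contDiff_Γy (D : DifferentialGauge EG G EH H) :
    ContDiff ℝ ∞ (F := EH) (fun p : ℝ × ℝ => D.Γy p.1 p.2) :=
  ContDiff.clm_apply (F := ℝ × ℝ) (G := EH) D.contDiff_Γ contDiff_const

end DifferentialGauge

variable [Group G] [LieGroup 𝓘(ℝ, EG) ∞ G] [LieGroup 𝓘(ℝ, EH) ∞ H]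

namespace Cocycle

variable {X : LieCrossedModule EG G EH H} (c : Cocycle X)

lemma isTransport_f : IsTransport (EG := EG) c.f := ⟨c.contMDiff_f, c.f_comp⟩

/-- The map `g` of a cocycle with its parameter `x` moved to the last place, so that it is a
transport in the direction of `y`. -/
def gSwap (y' y x : ℝ) : G := c.g x y' y

lemma isTransport_gSwap : IsTransport (EG := EG) c.gSwap where
  contMDiff := by
    have rotate : ContDiff ℝ ∞ (fun p : ℝ × ℝ × ℝ => (p.2.2, p.1, p.2.1)) := by fun_prop
    exact c.contMDiff_g.comp rotate.contMDiff
  comp y'' y' y x := c.g_comp x y'' y' y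

end Cocycle

namespace IntegralGauge

variable {X : LieCrossedModule EG G EH H} {c : Cocycle X} (T : IntegralGauge c)

lemma isCrossedTransport_Ψ : IsCrossedTransport X c.f T.Ψ := ⟨T.contMDiff_Ψ, T.Ψ_comp⟩

/-- The map `Φ` of a 1-gauge transformation with its parameter `x` moved to the last place, so that
it is a crossed transport in the direction of `y`. -/
def ΦSwap (y' y x : ℝ) : H := T.Φ x y' y

lemma isCrossedTransport_ΦSwap : IsCrossedTransport X c.gSwap T.ΦSwap where
  contMDiff := by
    have rotate : ContDiff ℝ ∞ (fun p : ℝ × ℝ × ℝ => (p.2.2, p.1, p.2.1)) := by fun_prop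
    exact T.contMDiff_Φ.comp rotate.contMDiff
  comp y'' y' y x := T.Φ_comp x y'' y' y

/-- The differential gauge transformation `(ϰ, Γ)` corresponding to `(κ, Ψ, Φ)`. -/
def toDifferential : DifferentialGauge EG G EH H where
  ϰ p := T.κ p.1 p.2
  Γ p := oneForm (F := EH) (-X.mDot (T.κ p.1 p.2) (generator EH T.Ψ p.1 p.2))
    (-X.mDot (T.κ p.1 p.2) (generator EH T.ΦSwap p.2 p.1))
  contMDiff_ϰ := T.contMDiff_κ
  contDiff_Γ := by
    have Ψ_generator := contDiff_generator T.contMDiff_Ψ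
    have Φ_generator : ContDiff ℝ ∞ (F := EH) (fun p : ℝ × ℝ => generator EH T.ΦSwap p.2 p.1) :=
      (contDiff_generator T.isCrossedTransport_ΦSwap.contMDiff).comp
        (contDiff_snd.prodMk contDiff_fst)
    exact contDiff_oneForm (ContDiff.neg (F := EH) (X.contDiff_mDot T.contMDiff_κ Ψ_generator))
      (ContDiff.neg (F := EH) (X.contDiff_mDot T.contMDiff_κ Φ_generator))

lemma toDifferential_Γx (x y : ℝ) :
    T.toDifferential.Γx x y = -X.mDot (T.κ x y) (generator EH T.Ψ x y) :=
  oneForm_dx (F := EH) _ _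

lemma toDifferential_Γy (x y : ℝ) :
    T.toDifferential.Γy x y = -X.mDot (T.κ x y) (generator EH T.ΦSwap y x) :=
  oneForm_dy (F := EH) _ _

lemma solvesLeftLog_Ψ (x₀ y : ℝ) : SolvesLeftLog (E := EH)
    (fun x => -X.mDot ((c.f x x₀ y)⁻¹ * (T.toDifferential.ϰ (x, y))⁻¹)
      (T.toDifferential.Γx x y)) x₀ (fun x => T.Ψ x x₀ y) := by
  convert T.isCrossedTransport_Ψ.solvesLeftLog c.isTransport_f x₀ y using 2 with x
  rw [T.toDifferential_Γx]
  exact (X.neg_mDot_neg_mDot _ _ _).trans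
    (congrArg (X.mDot · _) (inv_mul_cancel_right (c.f x x₀ y)⁻¹ (T.κ x y)))

lemma solvesLeftLog_Φ (x y₀ : ℝ) : SolvesLeftLog (E := EH)
    (fun y => -X.mDot ((c.g x y y₀)⁻¹ * (T.toDifferential.ϰ (x, y))⁻¹)
      (T.toDifferential.Γy x y)) y₀ (fun y => T.Φ x y y₀) := by
  convert T.isCrossedTransport_ΦSwap.solvesLeftLog c.isTransport_gSwap y₀ x using 2 with y
  · rw [T.toDifferential_Γy]
    exact (X.neg_mDot_neg_mDot _ _ _).trans
      (congrArg (X.mDot · _) (inv_mul_cancel_right (c.g x y y₀)⁻¹ (T.κ x y)))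
  · rfl

lemma toDifferential_injective :
    Function.Injective (toDifferential : IntegralGauge c → DifferentialGauge EG G EH H) := by
  intro T T' h
  ext x y z
  · exact congrFun (congrArg DifferentialGauge.ϰ h) (x, y)
  · exact congrFun ((h ▸ T.solvesLeftLog_Ψ y z).unique (T'.solvesLeftLog_Ψ y z)) x
  · exact congrFun ((h ▸ T.solvesLeftLog_Φ x z).unique (T'.solvesLeftLog_Φ x z)) y

lemma toDifferential_surjective [CompleteSpace EH] :
    Function.Surjective (toDifferential : IntegralGauge c → DifferentialGauge EG G EH H) := by
  intro D
  have ηx_smooth := ContDiff.neg (F := EH) (X.contDiff_mDot D.contMDiff_ϰ.inv D.contDiff_Γx)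
  have ηy_smooth := (ContDiff.neg (F := EH) (X.contDiff_mDot D.contMDiff_ϰ.inv D.contDiff_Γy)).comp
    (contDiff_snd.prodMk contDiff_fst : ContDiff ℝ ∞ fun p : ℝ × ℝ => (p.2, p.1))
  obtain ⟨Ψ, hΨ, Ψ_generator⟩ := exists_isCrossedTransport_generator_eq X c.isTransport_f ηx_smooth
  obtain ⟨Φ, hΦ, Φ_generator⟩ :=
    exists_isCrossedTransport_generator_eq X c.isTransport_gSwap ηy_smooth
  let T : IntegralGauge c :=
    { κ := fun x y => D.ϰ (x, y)
      Ψ := Ψ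
      Φ := fun x y' y => Φ y' y x
      contMDiff_κ := D.contMDiff_ϰ
      contMDiff_Ψ := hΨ.contMDiff
      contMDiff_Φ := by
        have rotate : ContDiff ℝ ∞ (fun p : ℝ × ℝ × ℝ => (p.2.1, p.2.2, p.1)) := by fun_prop
        exact hΦ.contMDiff.comp rotate.contMDiff
      Ψ_comp := hΨ.comp
      Φ_comp := fun x y'' y' y => hΦ.comp y'' y' y x }
  have recover (k : G) (v w : GroupLieAlgebra 𝓘(ℝ, EH) H) (hw : w = -X.mDot k⁻¹ v) :
      -X.mDot k w = v := by
    rw [hw, X.neg_mDot_neg_mDot, mul_inv_cancel, X.mDot_one]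
  exact ⟨T, DifferentialGauge.ext_components rfl
    (fun x y => (T.toDifferential_Γx x y).trans (recover _ _ _ (Ψ_generator x y)))
    (fun x y => (T.toDifferential_Γy x y).trans (recover _ _ _ (Φ_generator y x)))⟩

end IntegralGauge

end Correspondence

end HigherGauge

end

open HigherGauge in
theorem mainTheorem2_general
    {EG : Type*} [NormedAddCommGroup EG] [NormedSpace ℝ EG]
    {G : Type*} [TopologicalSpace G] [ChartedSpace EG G] [Group G]
    [LieGroup 𝓘(ℝ, EG) ∞ G]
    {EH : Type*} [NormedAddCommGroup EH] [NormedSpace ℝ EH] [CompleteSpace EH]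
    {H : Type*} [TopologicalSpace H] [ChartedSpace EH H] [Group H]
    [LieGroup 𝓘(ℝ, EH) ∞ H]
    (X : LieCrossedModule EG G EH H) (c : Cocycle X) :
    ∃ e : IntegralGauge c ≃ DifferentialGauge EG G EH H,
      (∀ (T : IntegralGauge c) (x y : ℝ),
        (e T).ϰ (x, y) = T.κ x y ∧
        (e T).Γx x y = -X.mDot (T.κ x y) (leftLogDeriv (fun x' => T.Ψ x' x y) x) ∧
        (e T).Γy x y = -X.mDot (T.κ x y) (leftLogDeriv (fun y' => T.Φ x y' y) y)) ∧
      (∀ D : DifferentialGauge EG G EH H,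
        (∀ x y : ℝ, (e.symm D).κ x y = D.ϰ (x, y)) ∧
        (∀ x₀ y : ℝ, IsUniqueSolutionLeftLog (E := EH)
          (fun x => -X.mDot ((c.f x x₀ y)⁻¹ * (D.ϰ (x, y))⁻¹) (D.Γx x y)) x₀
          (fun x => (e.symm D).Ψ x x₀ y)) ∧
        (∀ x y₀ : ℝ, IsUniqueSolutionLeftLog (E := EH)
          (fun y => -X.mDot ((c.g x y y₀)⁻¹ * (D.ϰ (x, y))⁻¹) (D.Γy x y)) y₀
          (fun y => (e.symm D).Φ x y y₀))) := by
  have bijective : Function.Bijective (IntegralGauge.toDifferential (c := c)) :=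
    ⟨IntegralGauge.toDifferential_injective, IntegralGauge.toDifferential_surjective⟩
  refine ⟨Equiv.ofBijective _ bijective,
    fun T x y => ⟨rfl, T.toDifferential_Γx x y, T.toDifferential_Γy x y⟩, fun D => ?_⟩
  obtain ⟨T, rfl⟩ := bijective.surjective D
  rw [Equiv.ofBijective_symm_apply_apply]
  exact ⟨fun x y => rfl,
    fun x₀ y => ⟨T.solvesLeftLog_Ψ x₀ y, fun γ hγ => hγ.unique (T.solvesLeftLog_Ψ x₀ y)⟩,
    fun x y₀ => ⟨T.solvesLeftLog_Φ x y₀, fun γ hγ => hγ.unique (T.solvesLeftLog_Φ x y₀)⟩⟩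

open HigherGauge in
theorem mainTheorem2
    {EG : Type*} [NormedAddCommGroup EG] [NormedSpace ℝ EG] [FiniteDimensional ℝ EG]
    {G : Type*} [TopologicalSpace G] [T2Space G] [ChartedSpace EG G] [Group G]
    [LieGroup 𝓘(ℝ, EG) ∞ G]
    {EH : Type*} [NormedAddCommGroup EH] [NormedSpace ℝ EH] [FiniteDimensional ℝ EH]
    {H : Type*} [TopologicalSpace H] [T2Space H] [ChartedSpace EH H] [Group H]
    [LieGroup 𝓘(ℝ, EH) ∞ H]
    (X : LieCrossedModule EG G EH H) (c : Cocycle X) :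
    ∃ e : IntegralGauge c ≃ DifferentialGauge EG G EH H,
      (∀ (T : IntegralGauge c) (x y : ℝ),
        (e T).ϰ (x, y) = T.κ x y ∧
        (e T).Γx x y = -X.mDot (T.κ x y) (leftLogDeriv (fun x' => T.Ψ x' x y) x) ∧
        (e T).Γy x y = -X.mDot (T.κ x y) (leftLogDeriv (fun y' => T.Φ x y' y) y)) ∧
      (∀ D : DifferentialGauge EG G EH H,
        (∀ x y : ℝ, (e.symm D).κ x y = D.ϰ (x, y)) ∧
        (∀ x₀ y : ℝ, IsUniqueSolutionLeftLog (E := EH)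
          (fun x => -X.mDot ((c.f x x₀ y)⁻¹ * (D.ϰ (x, y))⁻¹) (D.Γx x y)) x₀
          (fun x => (e.symm D).Ψ x x₀ y)) ∧
        (∀ x y₀ : ℝ, IsUniqueSolutionLeftLog (E := EH)
          (fun y => -X.mDot ((c.g x y y₀)⁻¹ * (D.ϰ (x, y))⁻¹) (D.Γy x y)) y₀
          (fun y => (e.symm D).Φ x y y₀))) := by
  have := FiniteDimensional.complete ℝ EH
  exact mainTheorem2_general X c
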